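/- For integers $N\ge 1$ and $j\ge 1$ let $P_N^{(j)}$ be the length of the $j$-th longest cycle of a uniformly random map $g:\mathbb{Z}_N\to\mathbb{Z}_N$. Here a cycle of $g$ of length $\ell$ is a sequence of distinct elements $x_0,\dots,x_{\ell-1}$ with $g(x_i)=x_{i+1}$ for $0\le i<\ell-1$ and $g(x_{\ell-1})=x_0$, taken up to rotation; lengths are listed in non-increasing order with one entry per cycle, and $P_N^{(j)}=0$ if $g$ has fewer than $j$ cycles. Let $Q_N^{(j)}$ be defined in the same way for a uniformly random permutation of $\mathbb{Z}_N$. Then for every $k\ge 1$ the random vectors $$N^{-1/2}\left(P_N^{(1)},P_N^{(2)},\dots,P_N^{(k)}\right)$$ converge in distribution, as $N\to\infty$, to a random vector in $\mathbb{R}^k$ that is nontrivial in the sense that none of its coordinates is almost surely constant. Moreover, the vectors $N^{-1}\left(Q_N^{(1)},\dots,Q_N^{(k)}\right)$ converge in distribution to a random vector $\left(Q^{(1)},\dots,Q^{(k)}\right)$, and the limit of the former vectors is distributed as $R\cdot\left(Q^{(1)},\dots,Q^{(k)}\right)$, where $R$ is independent of $\left(Q^{(1)},\dots,Q^{(k)}\right)$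 and has the Rayleigh density $x e^{-x^2/2}$ on $(0,\infty)$. -/

import Mathlib

open MeasureTheory Filter Topology Set

noncomputable section

/-- The set of cycles of a self-map `g` of a finite set: the periodic orbits
`(x, g x, …, g^[ℓ-1] x)` with distinct entries, taken up to rotation. -/
def cycleSet {α : Type*} [Fintype α] (g : α → α) : Finset (Cycle α) := by
  classical
  exact (Finset.univ.filter (fun x => x ∈ Function.periodicPts g)).image
    (Function.periodicOrbit g)

/-- The cycle lengths of `g`, one entry for each cycle, in non-increasing order. -/
def cycleLengths {α : Type*} [Fintype α] (g : α → α) : List ℕ :=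
  ((cycleSet g).val.map Cycle.length).sort (· ≥ ·)

/-- The length of the `j`-th longest cycle of `g`, for `j ≥ 1`; it is `0` if `g` has fewer than
`j` cycles. -/
def kthLongestCycle {α : Type*} [Fintype α] (g : α → α) (j : ℕ) : ℕ :=
  (cycleLengths g).getD (j - 1) 0

/-- The lengths of the `k` longest cycles of `g`, multiplied by `c`. -/
def scaledCycleVector {α : Type*} [Fintype α] (c : ℝ) (k : ℕ) (g : α → α) : Fin k → ℝ :=
  fun i => c * (kthLongestCycle g (i + 1) : ℝ)

instance nonempty_selfMap (N : ℕ) : Nonempty (Fin N → Fin N) := ⟨id⟩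

/-- The law of `N^{-1/2} (P_N^{(1)}, …, P_N^{(k)})`, where `P_N^{(j)}` is the `j`-th longest cycle
length of a uniformly random map of an `N`-element set into itself. -/
def randomMappingLaw (k N : ℕ) : ProbabilityMeasure (Fin k → ℝ) :=
  ⟨((PMF.uniformOfFintype (Fin N → Fin N)).map
      (scaledCycleVector (Real.sqrt N)⁻¹ k)).toMeasure, inferInstance⟩

/-- The law of `N^{-1} (Q_N^{(1)}, …, Q_N^{(k)})`, where `Q_N^{(j)}` is the `j`-th longest cycle
length of a uniformly random permutation of an `N`-element set. -/
def randomPermutationLaw (k N : ℕ) : ProbabilityMeasure (Fin k → ℝ) :=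
  ⟨((PMF.uniformOfFintype (Equiv.Perm (Fin N))).map
      (fun σ : Equiv.Perm (Fin N) => scaledCycleVector (N : ℝ)⁻¹ k σ)).toMeasure, inferInstance⟩

/-- The Rayleigh distribution, with density `x exp (-x² / 2)` on `(0, ∞)`. -/
def rayleighMeasure : Measure ℝ :=
  (volume.restrict (Ioi 0)).withDensity
    (fun x => ENNReal.ofReal (x * Real.exp (-x ^ 2 / 2)))

/-- The law of `R • Q`, where `R` is Rayleigh distributed, `Q` has law `μ`, and the two are
independent. -/
def rayleighMixture {k : ℕ} (μ : Measure (Fin k → ℝ)) : Measure (Fin k → ℝ) :=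
  (rayleighMeasure.prod μ).map (fun p => p.1 • p.2)

end

/-!
The proof couples everything on one probability space, that of an i.i.d. sequence `ω` of uniform
variables on `(0, 1]`.

*Permutations.* Break a stick of integer length `N` successively: a remaining stick of length `R`
loses a piece of length `⌈ω i * R⌉`, which is uniform on `{1, …, R}`. The multiset of the pieces has
the law of the cycle lengths of a uniformly random permutation (`sum_cycleMultiset_perm`), because
both follow Cauchy's formula `∏ 1 / (l ^ c_l * c_l !)`; for the stick this is an induction on the
number of pieces, based on `cauchyWeight_erase`. For fixed `ω`, each piece divided by `N` converges
as `N → ∞`, and the part of the stick left after `m` pieces is, up to an error `m / N`, the fraction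
`∏ i < m, (1 - ω i)`, which almost surely tends to `0`. Hence the normalized pieces are almost
surely uniformly Cauchy. As the `j`-th largest term is Lipschitz for the supremum norm
(`kthLargest_pieces_div_le`), the vectors of the longest pieces converge almost surely, to a vector
`X` with positive coordinates (`exists_tendsto_longestPieces`). In particular they converge in law.

*Maps.* A self-map of an `N`-element set is glued, in a unique way, from a permutation of the set
`S` of its periodic points and a forest with set of roots `S` (`sum_cycleMultiset_selfMap`).
By the generalized Cayley formula (`card_rootedForests`) there are `m N ^ (N - m - 1)` such forests
if `S` has `m` elements. So, given that there are `m` periodic points, the cycle lengths are those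
of a random permutation of `m` points, and the number of periodic points is `m` with probability
`m / N * ∏ i < m, (1 - i / N)` (`sum_cycleMultiset_eq_sum_cyclicProb`). At `m = ⌈r √N⌉`, this
probability times `√N` tends to `r * exp (-r ^ 2 / 2)` (`tendsto_sqrt_mul_cyclicProb`), while the
vector of longest pieces of a stick of length `m`, divided by `√N`, tends almost surely to `r • X`.
Writing the sum over `m` as an integral over `r`, dominated convergence yields the Rayleigh mixture
of the law of `X`. Since `X` has positive coordinates and the Rayleigh law has no atoms, neither do
the coordinates of the mixture.
-/

/-! ### Cycle lengths and Cauchy's formula -/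

/-- The multiset of the cycle lengths of a self-map. -/
noncomputable def cycleMultiset {α : Type*} [Fintype α] (g : α → α) : Multiset ℕ :=
  (cycleSet g).val.map Cycle.length

/-- The `j`-th largest element of a multiset of natural numbers (for `j ≥ 1`), and `0` if the
multiset has fewer than `j` elements. By definition, `kthLongestCycle g j` is
`kthLargest (cycleMultiset g) j`. -/
noncomputable def kthLargest (s : Multiset ℕ) (j : ℕ) : ℕ :=
  (s.sort (· ≥ ·)).getD (j - 1) 0

theorem mem_cycleSet {α : Type*} [Fintype α] {g : α → α} {c : Cycle α} :
    c ∈ cycleSet g ↔ ∃ x ∈ Function.periodicPts g, Function.periodicOrbit g x = c := by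
  classical
  simp [cycleSet]

theorem zero_notMem_cycleMultiset {α : Type*} [Fintype α] (g : α → α) :
    0 ∉ cycleMultiset g := by
  intro h
  obtain ⟨c, hc, h0⟩ := Multiset.mem_map.1 h
  obtain ⟨x, hx, rfl⟩ := mem_cycleSet.1 hc
  rw [Function.periodicOrbit_length] at h0
  exact (Function.minimalPeriod_pos_of_mem_periodicPts hx).ne' h0

/-- Each cycle of length `l` accounts for exactly `l` points of minimal period `l`. -/
theorem count_cycleMultiset_mul {α : Type*} [Fintype α] (g : α → α) {l : ℕ} (hl : l ≠ 0) :
    (cycleMultiset g).count l * l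
      = (Finset.univ.filter fun x => Function.minimalPeriod g x = l).card := by
  classical
  have hper : ∀ x, Function.minimalPeriod g x = l → x ∈ Function.periodicPts g := fun x hx =>
    Function.minimalPeriod_pos_iff_mem_periodicPts.1 (by omega)
  have hmaps : ∀ x ∈ (Finset.univ.filter fun x => Function.minimalPeriod g x = l),
      Function.periodicOrbit g x ∈ (cycleSet g).filter (fun c => c.length = l) := by
    intro x hx
    simp only [Finset.mem_filter, Finset.mem_univ, true_and] at hx
    rw [Finset.mem_filter, mem_cycleSet, Function.periodicOrbit_length]
    exact ⟨⟨x, hper x hx, rfl⟩, hx⟩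
  rw [Finset.card_eq_sum_card_fiberwise hmaps, Finset.sum_congr rfl (g := fun _ => l),
    Finset.sum_const, smul_eq_mul]
  · congr 1
    rw [cycleMultiset, Multiset.count_map]
    simp only [Finset.card, Finset.filter_val, eq_comm]
  · intro c hc
    rw [Finset.mem_filter, mem_cycleSet] at hc
    obtain ⟨⟨x, hx, rfl⟩, hlen⟩ := hc
    have hnd : (Function.periodicOrbit g x).Nodup := Function.nodup_periodicOrbit
    have hcard : (Function.periodicOrbit g x).toFinset.card = l := by
      rw [← hlen]
      generalize Function.periodicOrbit g x = c at hnd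
      induction c using Quotient.inductionOn with
      | _ L => exact List.toFinset_card_of_nodup hnd
    rw [← hcard]
    congr 1
    ext y
    have hmem : y ∈ (Function.periodicOrbit g x).toFinset ↔ y ∈ Function.periodicOrbit g x := by
      generalize Function.periodicOrbit g x = c
      induction c using Quotient.inductionOn with
      | _ L => exact List.mem_toFinset
    rw [hmem]
    simp only [Finset.mem_filter, Finset.mem_univ, true_and]
    constructor
    · rintro ⟨hy, h⟩
      rw [← h]
      exact Function.self_mem_periodicOrbit (hper y (hy.trans hcard))
    · intro hy
      obtain ⟨n, rfl⟩ := (Function.mem_periodicOrbit_iff hx).1 hy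
      rw [Function.minimalPeriod_apply_iterate hx, Function.periodicOrbit_apply_iterate_eq hx,
        ← Function.periodicOrbit_length]
      exact ⟨hlen.trans hcard.symm, rfl⟩

/-- The cycle lengths are determined by the number of points of each positive minimal period. This
identifies the cycle lengths of two maps without any bijection between their cycles. -/
theorem cycleMultiset_eq_of_count {α : Type*} [Fintype α] (g : α → α) (s : Multiset ℕ)
    (h0 : 0 ∉ s) (h : ∀ l ≠ 0, s.count l * l
      = (Finset.univ.filter fun x => Function.minimalPeriod g x = l).card) :
    cycleMultiset g = s := by
  ext l
  rcases eq_or_ne l 0 with rfl | hl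
  · rw [Multiset.count_eq_zero_of_notMem h0,
      Multiset.count_eq_zero_of_notMem (zero_notMem_cycleMultiset g)]
  · exact Nat.eq_of_mul_eq_mul_right (Nat.pos_of_ne_zero hl)
      ((count_cycleMultiset_mul g hl).trans (h l hl).symm)

theorem minimalPeriod_eq_card_support {α : Type*} [Fintype α] [DecidableEq α]
    (σ : Equiv.Perm α) {x : α} (hx : σ x ≠ x) :
    Function.minimalPeriod σ x = (σ.cycleOf x).support.card := by
  have hon := σ.isCycleOn_support_cycleOf x
  have hmem : x ∈ (σ.cycleOf x).support := by
    rw [Equiv.Perm.mem_support_cycleOf_iff' hx]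
  refine Nat.dvd_antisymm ?_ ?_
  · rw [← Function.isPeriodicPt_iff_minimalPeriod_dvd, Function.IsPeriodicPt, Function.IsFixedPt,
      Equiv.Perm.iterate_eq_pow]
    exact (hon.pow_apply_eq hmem).2 dvd_rfl
  · rw [← hon.pow_apply_eq hmem, ← Equiv.Perm.iterate_eq_pow]
    exact Function.iterate_minimalPeriod

/-- For a permutation, the cycle lengths are the cycle type completed by a `1` for each fixed
point. -/
theorem cycleMultiset_perm {α : Type*} [Fintype α] [DecidableEq α] (σ : Equiv.Perm α) :
    cycleMultiset σ = σ.partition.parts := by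
  refine cycleMultiset_eq_of_count _ _ (fun h => (σ.partition.parts_pos h).ne' rfl) fun l hl => ?_
  rw [Equiv.Perm.parts_partition, Multiset.count_add]
  rcases eq_or_ne l 1 with rfl | h1
  · rw [Multiset.count_eq_zero_of_notMem
      (fun h => (Equiv.Perm.one_lt_of_mem_cycleType h).ne' rfl), Multiset.count_replicate_self,
      zero_add, mul_one, ← Finset.card_compl]
    congr 1
    ext x
    simp [Function.minimalPeriod_eq_one_iff_isFixedPt, Function.IsFixedPt]
  · rw [Multiset.count_replicate, if_neg (Ne.symm h1), add_zero]
    have hmaps : ∀ x ∈ (Finset.univ.filter fun x => Function.minimalPeriod σ x = l),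
        σ.cycleOf x ∈ σ.cycleFactorsFinset.filter (fun c => c.support.card = l) := by
      intro x hx
      simp only [Finset.mem_filter, Finset.mem_univ, true_and] at hx
      have hne : σ x ≠ x := fun h => h1 (by
        rw [← hx]; exact Function.minimalPeriod_eq_one_iff_isFixedPt.2 h)
      rw [Finset.mem_filter, Equiv.Perm.cycleOf_mem_cycleFactorsFinset_iff,
        Equiv.Perm.mem_support, ← minimalPeriod_eq_card_support σ hne]
      exact ⟨hne, hx⟩
    rw [Finset.card_eq_sum_card_fiberwise hmaps, Finset.sum_congr rfl (g := fun _ => l),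
      Finset.sum_const, smul_eq_mul]
    · congr 1
      rw [Equiv.Perm.cycleType_def, Multiset.count_map, ← Finset.filter_val, Finset.card_val]
      refine congrArg _ (Finset.filter_congr fun c _ => eq_comm)
    · intro c hc
      rw [Finset.mem_filter] at hc
      obtain ⟨hc, hlen⟩ := hc
      rw [← hlen]
      congr 1
      ext y
      simp only [Finset.mem_filter, Finset.mem_univ, true_and]
      constructor
      · rintro ⟨hy, rfl⟩
        have hne : σ y ≠ y := fun h => h1 (by
          rw [← hlen, ← hy]; exact Function.minimalPeriod_eq_one_iff_isFixedPt.2 h)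
        rw [Equiv.Perm.mem_support_cycleOf_iff' hne]
      · intro hy
        have h2 := (Equiv.Perm.cycle_is_cycleOf hy hc).symm
        have hne : σ y ≠ y := by
          rw [← Equiv.Perm.mem_support]
          exact Equiv.Perm.mem_cycleFactorsFinset_support_le hc hy
        exact ⟨by rw [minimalPeriod_eq_card_support σ hne, h2, hlen], h2⟩

/-- The weight of a multiset of cycle lengths in Cauchy's formula: the inverse of
`∏ l ^ c_l * c_l !`. -/
noncomputable def cauchyWeight (s : Multiset ℕ) : ℝ :=
  ((s.prod * ∏ n ∈ s.toFinset, (s.count n).factorial : ℕ) : ℝ)⁻¹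

/-- Cauchy's formula for the number of permutations with given cycle lengths. -/
theorem card_perm_cycleMultiset (α : Type*) [Fintype α] [DecidableEq α] (s : Multiset ℕ) :
    ((Finset.univ.filter fun σ : Equiv.Perm α => cycleMultiset σ = s).card : ℝ)
      = if s.sum = Fintype.card α ∧ 0 ∉ s then
          (Fintype.card α).factorial * cauchyWeight s else 0 := by
  split_ifs with h
  · obtain ⟨hs, h0⟩ := h
    set m := s.filter (2 ≤ ·) with hm
    have hsm : s = m + Multiset.replicate (s.count 1) 1 := by
      ext l
      rw [Multiset.count_add, Multiset.count_replicate, hm, Multiset.count_filter]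
      rcases Nat.lt_or_ge l 2 with h2 | h2
      · interval_cases l
        · simp [Multiset.count_eq_zero_of_notMem h0]
        · simp
      · rw [if_pos h2, if_neg (by omega), add_zero]
    -- Mathlib's cycle type omits the fixed points, whose number is the multiplicity of `1`
    have hsum : Fintype.card α - m.sum = s.count 1 := by
      have := congrArg Multiset.sum hsm
      simp at this
      omega
    have hset : (Finset.univ.filter fun σ : Equiv.Perm α => cycleMultiset σ = s)
        = Finset.univ.filter fun σ : Equiv.Perm α => σ.cycleType = m := by
      ext σ
      simp only [Finset.mem_filter, Finset.mem_univ, true_and, cycleMultiset_perm]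
      constructor
      · intro h
        rw [← Equiv.Perm.filter_parts_partition_eq_cycleType, h]
      · intro h
        rw [Equiv.Perm.parts_partition, ← Equiv.Perm.sum_cycleType, h, hsum]
        exact hsm.symm
    have key := Equiv.Perm.card_of_cycleType_mul_eq α m
    rw [if_pos ⟨by rw [← hs, hsm]; simp, fun a ha => (Multiset.mem_filter.1 ha).2⟩, hsum] at key
    have hprod : s.prod = m.prod := by
      conv_lhs => rw [hsm]
      simp
    have hfac : ∏ n ∈ s.toFinset, (s.count n).factorial
        = (s.count 1).factorial * ∏ n ∈ m.toFinset, (m.count n).factorial := by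
      have hsub : s.toFinset ⊆ insert 1 m.toFinset := by
        intro a ha
        rw [Multiset.mem_toFinset] at ha
        rw [Finset.mem_insert, Multiset.mem_toFinset, hm, Multiset.mem_filter]
        have : a ≠ 0 := fun h => h0 (h ▸ ha)
        by_cases h1 : a = 1
        · exact Or.inl h1
        · exact Or.inr ⟨ha, by omega⟩
      rw [Finset.prod_subset hsub (fun a _ ha => by
        rw [Multiset.mem_toFinset] at ha
        rw [Multiset.count_eq_zero_of_notMem ha, Nat.factorial_zero]),
        Finset.prod_insert (by simp [hm])]
      congr 1
      refine Finset.prod_congr rfl fun a ha => ?_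
      rw [Multiset.mem_toFinset, hm, Multiset.mem_filter] at ha
      rw [hm, Multiset.count_filter_of_pos ha.2]
    have hpos : (0 : ℝ) < ((s.prod * ∏ n ∈ s.toFinset, (s.count n).factorial : ℕ) : ℝ) := by
      have : 0 < s.prod := Multiset.prod_pos fun a ha => Nat.pos_of_ne_zero fun h => h0 (h ▸ ha)
      have h2 : 0 < ∏ n ∈ s.toFinset, (s.count n).factorial :=
        Finset.prod_pos fun _ _ => Nat.factorial_pos _
      exact_mod_cast Nat.mul_pos this h2
    rw [cauchyWeight, ← div_eq_mul_inv, eq_div_iff hpos.ne', hset]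
    rw [hprod, hfac]
    have key' : (_ : ℝ) = _ := congrArg (Nat.cast) key
    push_cast at key' ⊢
    rw [← key']
    ring
  · rw [Nat.cast_eq_zero, Finset.card_eq_zero, Finset.filter_eq_empty_iff]
    rintro σ - rfl
    exact h ⟨by rw [cycleMultiset_perm, σ.partition.parts_sum], zero_notMem_cycleMultiset _⟩

/-- Removing a part `l` of multiplicity `c_l` multiplies the weight by `l * c_l`. -/
theorem cauchyWeight_erase {s : Multiset ℕ} {l : ℕ} (hl : l ∈ s) (h0 : 0 ∉ s) :
    cauchyWeight (s.erase l) = l * s.count l * cauchyWeight s := by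
  obtain ⟨t, rfl⟩ := Multiset.exists_cons_of_mem hl
  have hl0 : l ≠ 0 := fun h => h0 (h ▸ hl)
  have hl0' : (l : ℝ) ≠ 0 := by exact_mod_cast hl0
  rw [Multiset.erase_cons_head, cauchyWeight, cauchyWeight, Multiset.prod_cons,
    Multiset.count_cons_self]
  have hfac : ∏ n ∈ (l ::ₘ t).toFinset, ((l ::ₘ t).count n).factorial
      = (t.count l + 1) * ∏ n ∈ t.toFinset, (t.count n).factorial := by
    rw [Multiset.toFinset_cons]
    have h1 : ∏ n ∈ t.toFinset, (t.count n).factorial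
        = ∏ n ∈ insert l t.toFinset, (t.count n).factorial :=
      Finset.prod_subset (Finset.subset_insert _ _) (fun a _ ha => by
        rw [Multiset.mem_toFinset] at ha
        rw [Multiset.count_eq_zero_of_notMem ha, Nat.factorial_zero])
    rw [h1, ← Finset.mul_prod_erase _ _ (Finset.mem_insert_self l _),
      ← Finset.mul_prod_erase (insert l t.toFinset) (fun n => (t.count n).factorial)
        (Finset.mem_insert_self l _), Multiset.count_cons_self, Nat.factorial_succ, mul_assoc]
    congr 2
    refine Finset.prod_congr rfl fun a ha => ?_
    rw [Multiset.count_cons_of_ne (Finset.ne_of_mem_erase ha)]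
  rw [hfac]
  have : ((t.count l : ℝ) + 1) ≠ 0 := by positivity
  push_cast
  field_simp

/-! ### Rooted forests and periodic points of self-maps -/

/-- The self-maps of `α` that fix `S` pointwise and carry every point into `S` after finitely many
steps: the rooted forests on `α` with set of roots `S`, each vertex being sent to its parent. -/
noncomputable def rootedForests {α : Type*} [Fintype α] (S : Finset α) : Finset (α → α) := by
  classical
  exact Finset.univ.filter fun h => (∀ x ∈ S, h x = x) ∧ ∀ x, ∃ n, h^[n] x ∈ S

theorem mem_rootedForests {α : Type*} [Fintype α] {S : Finset α} {h : α → α} :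
    h ∈ rootedForests S ↔ (∀ x ∈ S, h x = x) ∧ ∀ x, ∃ n, h^[n] x ∈ S := by
  classical
  simp [rootedForests]

theorem iterate_eq_of_iterate_eq_fixed {α : Type*} {h : α → α} {x t : α} {n m : ℕ}
    (ht : h t = t) (hn : h^[n] x = t) (hnm : n ≤ m) : h^[m] x = t := by
  obtain ⟨k, rfl⟩ := Nat.exists_eq_add_of_le' hnm
  rw [Function.iterate_add_apply, hn, Function.iterate_fixed ht]

/-- In a rooted forest every vertex leads to exactly one root. -/
theorem root_unique {α : Type*} {h : α → α} {x s t : α} (hs : h s = s) (ht : h t = t)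
    (hxs : ∃ n, h^[n] x = s) (hxt : ∃ n, h^[n] x = t) : s = t := by
  obtain ⟨n, hn⟩ := hxs
  obtain ⟨m, hm⟩ := hxt
  rw [← iterate_eq_of_iterate_eq_fixed hs hn (le_max_left n m),
    ← iterate_eq_of_iterate_eq_fixed ht hm (le_max_right n m)]

/-- Two maps that agree off `v` have the same orbit up to the first visit to `v`. -/
theorem iterate_eq_or_hit {α : Type*} {h h' : α → α} {v : α} (hh : ∀ x, x ≠ v → h x = h' x)
    (x : α) (n : ℕ) : (∃ k, h^[k] x = v ∧ h'^[k] x = v) ∨ h^[n] x = h'^[n] x := by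
  induction n with
  | zero => exact Or.inr rfl
  | succ n ih =>
    rcases ih with ih | ih
    · exact Or.inl ih
    · by_cases hv : h^[n] x = v
      · exact Or.inl ⟨n, hv, ih ▸ hv⟩
      · right
        rw [Function.iterate_succ_apply', Function.iterate_succ_apply', ← ih, hh _ hv]

section Count
variable {α : Type*} [Fintype α] [DecidableEq α]

open scoped Classical in
/-- Cutting the edge from `v` to its parent `y` turns a forest with roots `S` into a forest with
roots `S ∪ {v}` together with a vertex `y` outside the tree of `v`. -/
theorem card_rootedForests_eq_sum {S : Finset α} {v : α} (hv : v ∉ S) :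
    (rootedForests S).card = ∑ h ∈ rootedForests (insert v S),
      (Finset.univ.filter fun y => ¬ ∃ n, h^[n] y = v).card := by
  rw [← Finset.card_sigma]
  refine Finset.card_bij' (fun h _ => ⟨Function.update h v v, h v⟩)
    (fun p _ => Function.update p.1 v p.2) ?_ ?_ ?_ ?_
  · intro h hh
    obtain ⟨hfix, hreach⟩ := mem_rootedForests.1 hh
    have hag : ∀ x, x ≠ v → h x = Function.update h v v x := fun x hx => by
      rw [Function.update_of_ne hx]
    rw [Finset.mem_sigma, mem_rootedForests, Finset.mem_filter]
    dsimp only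
    refine ⟨⟨fun x hx => ?_, fun x => ?_⟩, Finset.mem_univ _, ?_⟩
    · by_cases hxv : x = v
      · simp [hxv]
      · rw [Function.update_of_ne hxv]
        exact hfix x (Finset.mem_of_mem_insert_of_ne hx hxv)
    · obtain ⟨n, hn⟩ := hreach x
      rcases iterate_eq_or_hit hag x n with ⟨k, -, hk⟩ | hk
      · exact ⟨k, by simp [hk]⟩
      · exact ⟨n, by rw [← hk]; exact Finset.mem_insert_of_mem hn⟩
    · rintro ⟨n, hn⟩
      -- otherwise `v` would be a periodic point of `h`, hence a root
      have hper : ∃ k, h^[k + 1] v = v := by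
        rcases iterate_eq_or_hit hag (h v) n with ⟨k, hk, -⟩ | hk
        · exact ⟨k, hk⟩
        · exact ⟨n, hk.trans hn⟩
      obtain ⟨k, hk⟩ := hper
      obtain ⟨m, hm⟩ := hreach v
      have h1 : h^[m * (k + 1)] v = v := by
        rw [mul_comm, Function.iterate_mul]
        exact Function.iterate_fixed hk m
      have h2 := iterate_eq_of_iterate_eq_fixed (hfix _ hm) rfl
        (Nat.le_mul_of_pos_right m (Nat.succ_pos k))
      exact hv (by rw [← h1, h2]; exact hm)
  · rintro ⟨h, y⟩ hp
    rw [Finset.mem_sigma, mem_rootedForests, Finset.mem_filter] at hp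
    obtain ⟨⟨hfix, hreach⟩, -, hy⟩ := hp
    dsimp only at hfix hreach hy ⊢
    have hag : ∀ x, x ≠ v → Function.update h v y x = h x := fun x hx => by
      rw [Function.update_of_ne hx]
    have hyS : ∃ n, (Function.update h v y)^[n] y ∈ S := by
      obtain ⟨n, hn⟩ := hreach y
      have hnS : h^[n] y ∈ S := Finset.mem_of_mem_insert_of_ne hn fun h => hy ⟨n, h⟩
      rcases iterate_eq_or_hit hag y n with ⟨k, -, hk⟩ | hk
      · exact absurd ⟨k, hk⟩ hy
      · exact ⟨n, by rwa [hk]⟩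
    have hvS : ∀ x k, (Function.update h v y)^[k] x = v →
        ∃ n, (Function.update h v y)^[n] x ∈ S := by
      intro x k hk
      obtain ⟨n, hn⟩ := hyS
      refine ⟨n + 1 + k, ?_⟩
      rw [Function.iterate_add_apply, hk, Function.iterate_succ_apply, Function.update_self]
      exact hn
    rw [mem_rootedForests]
    refine ⟨fun x hx => ?_, fun x => ?_⟩
    · rw [Function.update_of_ne (by rintro rfl; exact hv hx)]
      exact hfix x (Finset.mem_insert_of_mem hx)
    · obtain ⟨n, hn⟩ := hreach x
      rcases iterate_eq_or_hit hag x n with ⟨k, hk, -⟩ | hk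
      · exact hvS x k hk
      · rcases Finset.mem_insert.1 hn with hn | hn
        · exact hvS x n (hk.trans hn)
        · exact ⟨n, by rwa [hk]⟩
  · intro h _
    simp
  · rintro ⟨h, y⟩ hp
    rw [Finset.mem_sigma, mem_rootedForests] at hp
    have : h v = v := hp.1.1 v (Finset.mem_insert_self _ _)
    simp [this]

open scoped Classical in
/-- The total size of the tree of a root, summed over all forests, is the same for all roots. -/
theorem sum_card_tree_eq (T : Finset α) {s t : α} (hs : s ∈ T) (ht : t ∈ T) :
    ∑ h ∈ rootedForests T, (Finset.univ.filter fun y => ∃ n, h^[n] y = s).card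
      = ∑ h ∈ rootedForests T, (Finset.univ.filter fun y => ∃ n, h^[n] y = t).card := by
  set τ : Equiv.Perm α := Equiv.swap s t with hτ
  have hττ : ∀ x, τ (τ x) = x := fun x => Equiv.swap_apply_self s t x
  have hT : ∀ x, x ∈ T → τ x ∈ T := by
    intro x hx
    rw [hτ, Equiv.swap_apply_def]
    split_ifs <;> assumption
  have hiter : ∀ (h : α → α) n x, (τ ∘ h ∘ τ)^[n] x = τ (h^[n] (τ x)) := by
    intro h n x
    have hsemi : Function.Semiconj τ (τ ∘ h ∘ τ) h := fun x => by simp [hττ]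
    rw [← (hsemi.iterate_right n) x, hττ]
  have hmem : ∀ h ∈ rootedForests T, τ ∘ h ∘ τ ∈ rootedForests T := by
    intro h hh
    rw [mem_rootedForests] at hh ⊢
    refine ⟨fun x hx => ?_, fun x => ?_⟩
    · simp [hh.1 _ (hT x hx), hττ]
    · obtain ⟨n, hn⟩ := hh.2 (τ x)
      exact ⟨n, by rw [hiter]; exact hT _ hn⟩
  have hinv : ∀ h : α → α, τ ∘ (τ ∘ h ∘ τ) ∘ τ = h := fun h => by
    funext x; simp [hττ]
  refine Finset.sum_nbij' (fun h => τ ∘ h ∘ τ) (fun h => τ ∘ h ∘ τ) hmem hmem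
    (fun h _ => hinv h) (fun h _ => hinv h) fun h _ => ?_
  refine Finset.card_bij' (fun y _ => τ y) (fun y _ => τ y) ?_ ?_ (fun y _ => hττ y)
    (fun y _ => hττ y)
  · intro y hy
    simp only [Finset.mem_filter, Finset.mem_univ, true_and, hiter, hττ] at hy ⊢
    obtain ⟨n, hn⟩ := hy
    exact ⟨n, by rw [hn, hτ, Equiv.swap_apply_left]⟩
  · intro y hy
    simp only [Finset.mem_filter, Finset.mem_univ, true_and, hiter] at hy ⊢
    obtain ⟨n, hn⟩ := hy
    refine ⟨n, ?_⟩
    rw [← hττ (h^[n] (τ y)), hn, hτ, Equiv.swap_apply_right]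

open scoped Classical in
/-- Making one more vertex `v` a root: for each forest with roots `S ∪ {v}`, the number of possible
parents of `v` is `N` minus the size of the tree of `v`, and this size is `N / (|S| + 1)` on average
because all roots play the same role. -/
theorem card_rootedForests_insert {S : Finset α} {v : α} (hv : v ∉ S) :
    (rootedForests S).card * (S.card + 1)
      = (rootedForests (insert v S)).card * (Fintype.card α * S.card) := by
  set T := insert v S with hT
  set B : α → ℕ := fun t =>
    ∑ h ∈ rootedForests T, (Finset.univ.filter fun y => ∃ n, h^[n] y = t).card with hB
  have h1 : (rootedForests S).card + B v = (rootedForests T).card * Fintype.card α := by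
    rw [card_rootedForests_eq_sum hv, ← Finset.sum_add_distrib, Finset.card_eq_sum_ones,
      Finset.sum_mul]
    refine Finset.sum_congr rfl fun h _ => ?_
    rw [add_comm, Finset.card_filter_add_card_filter_not, Finset.card_univ, one_mul]
  have h2 : ∑ t ∈ T, B t = (rootedForests T).card * Fintype.card α := by
    rw [hB, Finset.sum_comm, Finset.card_eq_sum_ones, Finset.sum_mul]
    refine Finset.sum_congr rfl fun h hh => ?_
    obtain ⟨hfix, hreach⟩ := mem_rootedForests.1 hh
    rw [one_mul, ← Finset.card_univ, ← Finset.card_biUnion]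
    · congr 1
      ext y
      simp only [Finset.mem_biUnion, Finset.mem_filter, Finset.mem_univ, true_and, iff_true]
      obtain ⟨n, hn⟩ := hreach y
      exact ⟨_, hn, n, rfl⟩
    · intro s hs t ht hst
      rw [Function.onFun, Finset.disjoint_left]
      intro y hys hyt
      rw [Finset.mem_filter] at hys hyt
      exact hst (root_unique (hfix s hs) (hfix t ht) hys.2 hyt.2)
  have h3 : ∑ t ∈ T, B t = (S.card + 1) * B v := by
    rw [Finset.sum_congr rfl fun t ht => sum_card_tree_eq T ht (Finset.mem_insert_self v S),
      Finset.sum_const, smul_eq_mul, hT, Finset.card_insert_of_notMem hv]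
  have h4 : (S.card + 1) * B v = (rootedForests T).card * Fintype.card α := h3.symm.trans h2
  nlinarith

/-- The generalized Cayley formula: there are `m N ^ (N - m - 1)` forests on `N` vertices with `m`
given roots. -/
theorem card_rootedForests (S : Finset α) :
    (rootedForests S).card * Fintype.card α
      = S.card * Fintype.card α ^ (Fintype.card α - S.card) := by
  induction hd : Fintype.card α - S.card generalizing S with
  | zero =>
    have hS : S = Finset.univ := (Finset.card_eq_iff_eq_univ S).1
      (le_antisymm (Finset.card_le_univ S) (by omega))
    have : rootedForests S = {id} := by
      ext h
      rw [mem_rootedForests, Finset.mem_singleton]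
      constructor
      · intro hh
        funext x
        exact hh.1 x (by simp [hS])
      · rintro rfl
        exact ⟨fun _ _ => rfl, fun x => ⟨0, by simp [hS]⟩⟩
    rw [this, hS]
    simp
  | succ d ih =>
    obtain ⟨v, hv⟩ : ∃ v, v ∉ S := by
      by_contra! hcon
      rw [Finset.eq_univ_iff_forall.2 hcon, Finset.card_univ] at hd
      omega
    have hcard := Finset.card_insert_of_notMem hv
    have h1 := ih (insert v S) (by omega)
    have h2 := card_rootedForests_insert hv
    rw [hcard] at h1
    refine Nat.eq_of_mul_eq_mul_right (Nat.lt_add_one_of_le (Nat.zero_le S.card)) ?_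
    calc (rootedForests S).card * Fintype.card α * (S.card + 1)
        = (rootedForests S).card * (S.card + 1) * Fintype.card α := by ring
      _ = (rootedForests (insert v S)).card * Fintype.card α
          * (S.card * Fintype.card α) := by rw [h2]; ring
      _ = _ := by rw [h1]; ring


theorem exists_iterate_mem_periodicPts {α : Type*} [Finite α] (g : α → α) (x : α) :
    ∃ n, g^[n] x ∈ Function.periodicPts g := by
  obtain ⟨i, j, hij, h⟩ := Finite.exists_ne_map_eq_of_infinite fun n : ℕ => g^[n] x
  wlog hlt : i < j generalizing i j
  · exact this j i hij.symm h.symm (lt_of_le_of_ne (not_lt.1 hlt) hij.symm)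
  refine ⟨i, j - i, Nat.sub_pos_of_lt hlt, ?_⟩
  rw [Function.IsPeriodicPt, Function.IsFixedPt, ← Function.iterate_add_apply,
    Nat.sub_add_cancel hlt.le]
  exact h.symm

/-- Composing a map with a permutation of `S` does not change its orbits before they enter `S`. -/
theorem iterate_comp_perm_eq_or_mem {α : Type*} {S : Finset α} {σ : Equiv.Perm α}
    (hσ : ∀ x ∉ S, σ x = x) (hσS : ∀ x ∈ S, σ x ∈ S) (h : α → α) (x : α) (n : ℕ) :
    (∃ k, (σ ∘ h)^[k] x ∈ S ∧ h^[k] x ∈ S) ∨ (σ ∘ h)^[n] x = h^[n] x := by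
  induction n with
  | zero => exact Or.inr rfl
  | succ n ih =>
    rcases ih with ih | ih
    · exact Or.inl ih
    · have h1 : (σ ∘ h)^[n + 1] x = σ (h^[n + 1] x) := by
        rw [Function.iterate_succ_apply', Function.iterate_succ_apply', ih, Function.comp]
      by_cases hS : h^[n + 1] x ∈ S
      · exact Or.inl ⟨n + 1, by rw [h1]; exact hσS _ hS, hS⟩
      · exact Or.inr (by rw [h1, hσ _ hS])

theorem exists_iterate_mem_iff_comp_perm {α : Type*} {S : Finset α} {σ : Equiv.Perm α}
    (hσ : ∀ x ∉ S, σ x = x) (hσS : ∀ x ∈ S, σ x ∈ S) (h : α → α) (x : α) :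
    (∃ n, (σ ∘ h)^[n] x ∈ S) ↔ ∃ n, h^[n] x ∈ S := by
  constructor <;> rintro ⟨n, hn⟩ <;>
    rcases iterate_comp_perm_eq_or_mem hσ hσS h x n with ⟨k, h1, h2⟩ | h1
  exacts [⟨k, h2⟩, ⟨n, h1 ▸ hn⟩, ⟨k, h1⟩, ⟨n, by rwa [h1]⟩]


/-- A map glued from a permutation of `S` and a forest rooted at `S` acts on `S` as the
permutation. -/
theorem semiconj_glue {S : Finset α} {h : α → α} (hh : h ∈ rootedForests S)
    (π : Equiv.Perm S) :
    Function.Semiconj (Subtype.val : S → α) π (Equiv.Perm.ofSubtype π ∘ h) := by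
  intro x
  rw [Function.comp, (mem_rootedForests.1 hh).1 _ x.2, Equiv.Perm.ofSubtype_apply_coe]

/-- The periodic points of a map glued from a permutation of `S` and a forest rooted at `S` are
the elements of `S`. -/
theorem periodicPts_glue {S : Finset α} {h : α → α} (hh : h ∈ rootedForests S)
    (π : Equiv.Perm S) : Function.periodicPts (Equiv.Perm.ofSubtype π ∘ h) = S := by
  have hsemi := semiconj_glue hh π
  ext x
  constructor
  · intro hx
    have hσ : ∀ x ∉ S, Equiv.Perm.ofSubtype π x = x := fun x hx =>
      Equiv.Perm.ofSubtype_apply_of_not_mem π hx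
    have hσS : ∀ x ∈ S, Equiv.Perm.ofSubtype π x ∈ S := fun x hx => by
      rw [Equiv.Perm.ofSubtype_apply_of_mem π hx]
      exact (π _).2
    obtain ⟨n, hn⟩ := (exists_iterate_mem_iff_comp_perm hσ hσS h x).2
      ((mem_rootedForests.1 hh).2 x)
    obtain ⟨p, hp, hper⟩ := hx
    have h1 : (Equiv.Perm.ofSubtype π ∘ h)^[p * n] x = x := hper.mul_const n
    obtain ⟨k, hk⟩ := Nat.exists_eq_add_of_le' (Nat.le_mul_of_pos_left n hp)
    rw [hk, Function.iterate_add_apply, ← Subtype.coe_mk _ hn, ← (hsemi.iterate_right k) _] at h1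
    rw [← h1]
    exact (π^[k] ⟨_, hn⟩).2
  · intro hx
    have h1 : (⟨x, hx⟩ : S) ∈ Function.periodicPts π :=
      ⟨orderOf π, orderOf_pos π, by
        rw [Function.IsPeriodicPt, Function.IsFixedPt, Equiv.Perm.iterate_eq_pow,
          pow_orderOf_eq_one, Equiv.Perm.one_apply]⟩
    exact hsemi.mapsTo_periodicPts h1

theorem cycleMultiset_glue {S : Finset α} {h : α → α} (hh : h ∈ rootedForests S)
    (π : Equiv.Perm S) :
    cycleMultiset (Equiv.Perm.ofSubtype π ∘ h) = cycleMultiset π := by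
  refine cycleMultiset_eq_of_count _ _ (zero_notMem_cycleMultiset _) fun l hl => ?_
  rw [count_cycleMultiset_mul _ hl]
  have hmin : ∀ x : S, Function.minimalPeriod (Equiv.Perm.ofSubtype π ∘ h) x
      = Function.minimalPeriod π x := by
    intro x
    rw [Function.minimalPeriod_eq_minimalPeriod_iff]
    intro n
    rw [Function.IsPeriodicPt, Function.IsFixedPt, Function.IsPeriodicPt, Function.IsFixedPt,
      ← ((semiconj_glue hh π).iterate_right n) x, Subtype.coe_inj]
  refine Finset.card_nbij Subtype.val ?_ (Subtype.val_injective.injOn) ?_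
  · intro x hx
    simp only [Finset.mem_coe, Finset.mem_filter, Finset.mem_univ, true_and] at hx ⊢
    rw [hmin, hx]
  · intro x hx
    simp only [Finset.coe_filter, Finset.mem_univ, true_and, mem_ofPred_eq] at hx
    have hxS : x ∈ S := by
      have : x ∈ Function.periodicPts (Equiv.Perm.ofSubtype π ∘ h) :=
        Function.minimalPeriod_pos_iff_mem_periodicPts.1 (by omega)
      rwa [periodicPts_glue hh] at this
    exact ⟨⟨x, hxS⟩, by simpa [← hmin] using hx, rfl⟩


/-- A self-map is glued, in a unique way, from a permutation of its periodic points and a forest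
rooted at them. -/
theorem sum_cycleMultiset_selfMap (F : Multiset ℕ → ℝ) :
    ∑ g : α → α, F (cycleMultiset g) = ∑ S : Finset α,
      ((rootedForests S).card : ℝ) * ∑ π : Equiv.Perm S, F (cycleMultiset π) := by
  classical
  rw [← Finset.sum_fiberwise_of_maps_to (s := Finset.univ) (t := Finset.univ)
    (g := fun g : α → α => (Function.periodicPts g).toFinset) (fun _ _ => Finset.mem_univ _)]
  refine Finset.sum_congr rfl fun S _ => ?_
  rw [← nsmul_eq_mul, ← Finset.sum_const, ← Finset.sum_product']
  symm
  refine Finset.sum_bij (fun p _ => Equiv.Perm.ofSubtype p.2 ∘ p.1) ?_ ?_ ?_ ?_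
  · rintro ⟨h, π⟩ hp
    rw [Finset.mem_product] at hp
    rw [Finset.mem_filter]
    refine ⟨Finset.mem_univ _, ?_⟩
    ext x
    simp [periodicPts_glue hp.1]
  · rintro ⟨h, π⟩ hp ⟨h', π'⟩ hp' heq
    rw [Finset.mem_product] at hp hp'
    dsimp only at hp hp' heq
    have hπ : π = π' := by
      ext x
      rw [semiconj_glue hp.1 π x, semiconj_glue hp'.1 π' x, heq]
    subst hπ
    refine Prod.ext ?_ rfl
    funext x
    exact (Equiv.Perm.ofSubtype π).injective (congrFun heq x)
  · intro g hg
    rw [Finset.mem_filter] at hg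
    have hmem : ∀ x, x ∈ S ↔ x ∈ Function.periodicPts g := fun x => by
      rw [← hg.2, Set.mem_toFinset]
    have hbij : Set.BijOn g S S := by
      have : (S : Set α) = Function.periodicPts g := by ext x; simp [hmem]
      rw [this]
      exact Function.bijOn_periodicPts g
    let π : Equiv.Perm S := hbij.equiv g
    have hπ : ∀ x : S, (π x : α) = g x := fun x => rfl
    have hg' : Equiv.Perm.ofSubtype π ∘ ((Equiv.Perm.ofSubtype π).symm ∘ g) = g := by
      funext x
      simp
    refine ⟨((Equiv.Perm.ofSubtype π).symm ∘ g, π), ?_, hg'⟩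
    rw [Finset.mem_product, mem_rootedForests]
    refine ⟨⟨fun x hx => ?_, fun x => ?_⟩, Finset.mem_univ _⟩
    · change (Equiv.Perm.ofSubtype π).symm (g x) = x
      rw [Equiv.symm_apply_eq, Equiv.Perm.ofSubtype_apply_of_mem π hx]
      exact (hπ ⟨x, hx⟩).symm
    · rw [← exists_iterate_mem_iff_comp_perm (σ := Equiv.Perm.ofSubtype π)
        (fun x hx => Equiv.Perm.ofSubtype_apply_of_not_mem π hx)
        (fun x hx => by rw [Equiv.Perm.ofSubtype_apply_of_mem π hx]; exact (π _).2), hg']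
      obtain ⟨n, hn⟩ := exists_iterate_mem_periodicPts g x
      exact ⟨n, (hmem _).2 hn⟩
  · rintro ⟨h, π⟩ hp
    rw [Finset.mem_product] at hp
    exact congrArg F (cycleMultiset_glue hp.1 π).symm

end Count

/-! ### The stick-breaking process -/

/-- A finite sum as the integral of a step function with steps of width `1 / c`. -/
theorem intervalIntegral_comp_ceil {c : ℝ} (hc : 0 < c) (a : ℕ → ℝ) (M : ℕ) :
    ∫ r in (0 : ℝ)..(M / c), a ⌈r * c⌉₊ = c⁻¹ * ∑ l ∈ Finset.Icc 1 M, a l := by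
  have hcongr : ∀ k : ℕ, ∀ r ∈ Set.uIoc ((k : ℝ) / c) (((k + 1 : ℕ) : ℝ) / c),
      a ⌈r * c⌉₊ = a (k + 1) := by
    intro k r hr
    rw [Set.uIoc_of_le (by gcongr; simp), Set.mem_Ioc, div_lt_iff₀ hc, le_div_iff₀ hc] at hr
    congr 1
    rw [Nat.ceil_eq_iff (Nat.succ_ne_zero k)]
    simpa using hr
  have hle : ∀ k : ℕ, (k : ℝ) / c ≤ ((k + 1 : ℕ) : ℝ) / c := fun k => by gcongr; simp
  have hsum : ∑ l ∈ Finset.Icc 1 M, a l = ∑ k ∈ Finset.range M, a (k + 1) := by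
    induction M with
    | zero => simp
    | succ M ih => rw [Finset.sum_Icc_succ_top (by omega), Finset.sum_range_succ, ih]
  have h0 : (0 : ℝ) = ((0 : ℕ) : ℝ) / c := by simp
  rw [h0, ← intervalIntegral.sum_integral_adjacent_intervals (a := fun k : ℕ => (k : ℝ) / c)
    (fun k _ => ?_), hsum, Finset.mul_sum]
  · refine Finset.sum_congr rfl fun k _ => ?_
    rw [intervalIntegral.integral_of_le (hle k), setIntegral_congr_fun measurableSet_Ioc
      (g := fun _ => a (k + 1)) (fun r hr => hcongr k r (by rwa [Set.uIoc_of_le (hle k)])),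
      ← intervalIntegral.integral_of_le (hle k), intervalIntegral.integral_const, smul_eq_mul]
    push_cast
    ring
  · refine (intervalIntegrable_const (c := a (k + 1))).congr fun r hr => ?_
    exact (hcongr k r hr).symm

/-- The uniform distribution on `(0, 1]`. -/
noncomputable def uniformUnit : Measure ℝ := volume.restrict (Ioc 0 1)

instance : IsProbabilityMeasure uniformUnit := ⟨by simp [uniformUnit]⟩

/-- The law of a sequence of independent uniform variables on `(0, 1]`. -/
noncomputable def iidUniform : Measure (ℕ → ℝ) := Measure.infinitePi fun _ => uniformUnit

instance : IsProbabilityMeasure iidUniform := by unfold iidUniform; infer_instance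

theorem ae_mem_Ioo_iidUniform : ∀ᵐ ω ∂iidUniform, ∀ i, ω i ∈ Ioo (0 : ℝ) 1 := by
  rw [ae_all_iff]
  intro i
  have h : ∀ᵐ u ∂uniformUnit, u ∈ Ioo (0 : ℝ) 1 := by
    rw [uniformUnit, ← Measure.restrict_congr_set Ioo_ae_eq_Ioc]
    exact ae_restrict_mem measurableSet_Ioo
  exact (measurePreserving_eval_infinitePi (fun _ : ℕ => uniformUnit) i).quasiMeasurePreserving.ae h

/-- The sequence without its first term. -/
def shift (ω : ℕ → ℝ) : ℕ → ℝ := fun n => ω (n + 1)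

theorem measurable_shift : Measurable shift := by
  unfold shift
  fun_prop

/-- The first term of an i.i.d. sequence is independent of the shifted sequence, which has the
same law as the whole sequence. -/
theorem measurePreserving_head_shift :
    MeasurePreserving (fun ω : ℕ → ℝ => (ω 0, shift ω)) iidUniform
      (uniformUnit.prod iidUniform) := by
  have hm : Measurable fun ω : ℕ → ℝ => (ω 0, shift ω) :=
    (measurable_pi_apply 0).prodMk measurable_shift
  set cons : ℝ × (ℕ → ℝ) → ℕ → ℝ := fun p n => Nat.casesOn n p.1 p.2 with hcons
  have hcm : Measurable cons := by
    rw [measurable_pi_iff]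
    rintro (_ | n)
    · exact measurable_fst
    · exact (measurable_pi_apply n).comp measurable_snd
  have hmap : (uniformUnit.prod iidUniform).map cons = iidUniform := by
    refine Measure.eq_infinitePi _ fun s t ht => ?_
    rw [Measure.map_apply hcm (MeasurableSet.pi s.countable_toSet fun i _ => ht i)]
    -- enlarge the index set to an initial segment, by factors that are the whole space
    classical
    set t' : ℕ → Set ℝ := fun i => if i ∈ s then t i else univ with ht'
    have ht'm : ∀ i, MeasurableSet (t' i) := fun i => by
      rw [ht']
      dsimp only
      split_ifs
      exacts [ht i, .univ]
    obtain ⟨n, hn⟩ := s.exists_nat_subset_range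
    have hc0 : ∀ u ω, cons (u, ω) 0 = u := fun _ _ => rfl
    have hpre : cons ⁻¹' (s : Set ℕ).pi t
        = t' 0 ×ˢ ((Finset.range n : Set ℕ).pi fun i => t' (i + 1)) := by
      ext ⟨u, ω⟩
      simp only [mem_preimage, Set.mem_pi, mem_prod, Finset.mem_coe, Finset.mem_range]
      constructor
      · intro h
        refine ⟨?_, fun i _ => ?_⟩
        · by_cases h0 : 0 ∈ s
          · simpa [ht', h0, hc0] using h 0 h0
          · simp [ht', h0]
        · by_cases hi : i + 1 ∈ s
          · simpa [ht', hi] using h (i + 1) hi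
          · simp [ht', hi]
      · rintro ⟨h0, h⟩ (_ | i) hi
        · simpa [ht', hi, hc0] using h0
        · have := h i (by have := Finset.mem_range.1 (hn hi); omega)
          simpa [ht', hi] using this
    have hprod : ∏ i ∈ s, uniformUnit (t i) = ∏ i ∈ Finset.range (n + 1), uniformUnit (t' i) := by
      rw [← Finset.prod_subset (hn.trans (Finset.range_subset_range.2 n.le_succ))
        (fun i _ hi => by simp [ht', hi])]
      exact Finset.prod_congr rfl fun i hi => by simp [ht', hi]
    rw [hpre, Measure.prod_prod, iidUniform, Measure.infinitePi_pi _ fun i _ => ht'm _, hprod,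
      Finset.prod_range_succ', mul_comm]
  refine ⟨hm, ?_⟩
  nth_rewrite 1 [← hmap]
  rw [Measure.map_map hm hcm]
  have : (fun ω : ℕ → ℝ => (ω 0, shift ω)) ∘ cons = id := rfl
  rw [this, Measure.map_id]

/-- The length that remains of a stick of length `N` after `m` pieces have been broken off: the
piece broken off a stick of length `R` at step `i` has length `⌈ω i * R⌉`. If `ω i` is uniform
on `(0, 1]`, this length is uniform on `{1, …, R}`. -/
noncomputable def remainder : ℕ → (ℕ → ℝ) → ℕ → ℕ
  | N, _, 0 => N
  | N, ω, m + 1 => remainder (N - ⌈ω 0 * N⌉₊) (shift ω) m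

/-- The length of the `i`-th piece broken off a stick of length `N`. -/
noncomputable def piece (N : ℕ) (ω : ℕ → ℝ) (i : ℕ) : ℕ :=
  remainder N ω i - remainder N ω (i + 1)

/-- The nonzero lengths among the first `n` pieces broken off a stick of length `N`. -/
noncomputable def pieces (n N : ℕ) (ω : ℕ → ℝ) : Multiset ℕ :=
  ((Multiset.range n).map (piece N ω)).filter (· ≠ 0)

theorem measurable_remainder (N m : ℕ) : Measurable fun ω => remainder N ω m := by
  induction m generalizing N with
  | zero => exact measurable_const
  | succ m ih =>
    have h1 : Measurable fun p : ℕ × (ℕ → ℝ) => remainder p.1 p.2 m :=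
      measurable_from_prod_countable_right fun n => ih n
    have h2 : Measurable fun ω : ℕ → ℝ => (N - ⌈ω 0 * N⌉₊, shift ω) := by
      refine Measurable.prodMk ?_ measurable_shift
      have : Measurable fun ω : ℕ → ℝ => ⌈ω 0 * N⌉₊ :=
        Nat.measurable_ceil.comp ((measurable_pi_apply 0).mul_const _)
      exact (Measurable.of_discrete (f := fun k : ℕ => N - k)).comp this
    exact h1.comp h2

/-- The multisets of natural numbers form a countable set, with all subsets measurable. -/
instance : MeasurableSpace (Multiset ℕ) := ⊤

instance : DiscreteMeasurableSpace (Multiset ℕ) := ⟨fun _ => trivial⟩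

theorem measurable_pieces (n N : ℕ) : Measurable (pieces n N) := by
  have h1 : Measurable fun ω => fun i : Fin n => piece N ω i := by
    rw [measurable_pi_iff]
    intro i
    exact (Measurable.of_discrete (f := fun p : ℕ × ℕ => p.1 - p.2)).comp
      ((measurable_remainder N i).prodMk (measurable_remainder N (i + 1)))
  have h2 : pieces n N = (fun v : Fin n → ℕ => ((Finset.univ.val.map v).filter (· ≠ 0)))
      ∘ fun ω => fun i : Fin n => piece N ω i := by
    funext ω
    rw [Function.comp, pieces]
    congr 1
    change (((List.range n).map (piece N ω) : List ℕ) : Multiset ℕ)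
      = (((List.finRange n).map fun i : Fin n => piece N ω i : List ℕ) : Multiset ℕ)
    rw [← List.map_coe_finRange_eq_range, List.map_map]
    rfl
  rw [h2]
  exact Measurable.of_discrete.comp h1

theorem remainder_zero (ω : ℕ → ℝ) (m : ℕ) : remainder 0 ω m = 0 := by
  induction m generalizing ω with
  | zero => rfl
  | succ m ih =>
    rw [remainder, Nat.zero_sub]
    exact ih _

theorem pieces_zero (n : ℕ) (ω : ℕ → ℝ) : pieces n 0 ω = 0 := by
  rw [pieces, Multiset.filter_eq_nil]
  intro a ha
  obtain ⟨i, -, rfl⟩ := Multiset.mem_map.1 ha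
  simp [piece, remainder_zero]

theorem ceil_mul_mem_Icc {N : ℕ} (hN : N ≠ 0) {u : ℝ} (hu : u ∈ Ioc (0 : ℝ) 1) :
    ⌈u * N⌉₊ ∈ Finset.Icc 1 N := by
  have hN' : (0 : ℝ) < N := by positivity
  rw [Finset.mem_Icc, Nat.one_le_ceil_iff, Nat.ceil_le]
  exact ⟨mul_pos hu.1 hN', mul_le_of_le_one_left hN'.le hu.2⟩

/-- The pieces of a stick are its first piece and the pieces of the rest. -/
theorem pieces_succ (n : ℕ) {N : ℕ} (hN : N ≠ 0) {ω : ℕ → ℝ} (hω : ω 0 ∈ Ioc (0 : ℝ) 1) :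
    pieces (n + 1) N ω = ⌈ω 0 * N⌉₊ ::ₘ pieces n (N - ⌈ω 0 * N⌉₊) (shift ω) := by
  have hl := Finset.mem_Icc.1 (ceil_mul_mem_Icc hN hω)
  have h0 : piece N ω 0 = ⌈ω 0 * N⌉₊ := by
    rw [piece, remainder, remainder, remainder]
    omega
  have hrange : Multiset.range (n + 1) = 0 ::ₘ (Multiset.range n).map Nat.succ := by
    rw [Multiset.range, List.range_succ_eq_map]
    rfl
  rw [pieces, hrange, Multiset.map_cons, Multiset.filter_cons_of_pos _ (by rw [h0]; omega), h0,
    Multiset.map_map]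
  rfl

/-- The lengths of the pieces of a stick of length `N` follow Cauchy's formula. -/
theorem iidUniform_real_pieces_eq (n : ℕ) {N : ℕ} (hN : N ≤ n) (s : Multiset ℕ) :
    iidUniform.real {ω | pieces n N ω = s}
      = if s.sum = N ∧ 0 ∉ s then cauchyWeight s else 0 := by
  have hzero : ∀ n s, iidUniform.real {ω | pieces n 0 ω = s}
      = if s.sum = 0 ∧ 0 ∉ s then cauchyWeight s else 0 := by
    intro n s
    simp only [pieces_zero]
    by_cases hs : s = 0
    · simp [hs, cauchyWeight]
    · have h1 : ¬ (s.sum = 0 ∧ 0 ∉ s) := by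
        rintro ⟨h1, h2⟩
        obtain ⟨a, ha⟩ := Multiset.exists_mem_of_ne_zero hs
        exact h2 (Multiset.sum_eq_zero_iff.1 h1 a ha ▸ ha)
      simp [h1, Ne.symm hs]
  induction n generalizing N s with
  | zero =>
    obtain rfl : N = 0 := by omega
    exact hzero 0 s
  | succ n ih =>
    rcases eq_or_ne N 0 with rfl | hN0
    · exact hzero _ s
    have hNpos : (0 : ℝ) < N := by positivity
    set G : ℕ × (ℕ → ℝ) → Multiset ℕ := fun q => q.1 ::ₘ pieces n (N - q.1) q.2 with hG
    have hGm : Measurable G := measurable_from_prod_countable_right fun l =>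
      (Measurable.of_discrete (f := fun t : Multiset ℕ => l ::ₘ t)).comp
        (measurable_pieces n (N - l))
    set E : Set (ℝ × (ℕ → ℝ)) := {p | G (⌈p.1 * N⌉₊, p.2) = s} with hE
    have hEm : MeasurableSet E := by
      have : Measurable fun p : ℝ × (ℕ → ℝ) => G (⌈p.1 * N⌉₊, p.2) :=
        hGm.comp ((Nat.measurable_ceil.comp (measurable_fst.mul_const _)).prodMk measurable_snd)
      exact this (measurableSet_singleton s)
    have hstep : iidUniform.real {ω | pieces (n + 1) N ω = s}
        = ∫ u, iidUniform.real {ω | G (⌈u * N⌉₊, ω) = s} ∂uniformUnit := by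
      have h1 : {ω | pieces (n + 1) N ω = s} =ᵐ[iidUniform]
          (fun ω : ℕ → ℝ => (ω 0, shift ω)) ⁻¹' E := by
        filter_upwards [ae_mem_Ioo_iidUniform] with ω hω
        apply propext
        change pieces (n + 1) N ω = s ↔ _
        rw [pieces_succ n hN0 (Ioo_subset_Ioc_self (hω 0))]
        rfl
      rw [measureReal_congr h1, measureReal_def,
        measurePreserving_head_shift.measure_preimage hEm.nullMeasurableSet,
        Measure.prod_apply hEm, ← integral_toReal
          (measurable_measure_prodMk_left hEm).aemeasurable
          (ae_of_all _ fun _ => measure_lt_top _ _)]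
      rfl
    have hterm : ∀ l ∈ Finset.Icc 1 N, iidUniform.real {ω | G (l, ω) = s}
        = if s.sum = N ∧ 0 ∉ s then l * s.count l * cauchyWeight s else 0 := by
      intro l hl
      rw [Finset.mem_Icc] at hl
      by_cases hls : l ∈ s
      · have hset : {ω | G (l, ω) = s} = {ω | pieces n (N - l) ω = s.erase l} := by
          ext ω
          change l ::ₘ _ = s ↔ _ = s.erase l
          nth_rewrite 1 [← Multiset.cons_erase hls]
          exact Multiset.cons_inj_right l
        have hsum : s.sum = l + (s.erase l).sum := by
          rw [← Multiset.sum_cons, Multiset.cons_erase hls]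
        have h0 : 0 ∉ s.erase l ↔ 0 ∉ s := by
          rw [Multiset.mem_erase_of_ne (by omega)]
        have hiff : ((s.erase l).sum = N - l ∧ 0 ∉ s.erase l) ↔ (s.sum = N ∧ 0 ∉ s) := by
          rw [h0]
          exact and_congr_left fun _ => by omega
        -- a first piece `l` leaves the parts other than `l` for a stick of length `N - l`
        rw [hset, ih (by omega), if_congr hiff rfl rfl]
        split_ifs with h
        exacts [cauchyWeight_erase hls h.2, rfl]
      · have hset : {ω | G (l, ω) = s} = ∅ := by
          ext ω
          simp only [mem_ofPred_eq, mem_empty_iff_false, iff_false]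
          intro h
          exact hls (h ▸ Multiset.mem_cons_self _ _)
        rw [hset, Multiset.count_eq_zero_of_notMem hls]
        simp
    rw [hstep, uniformUnit, ← intervalIntegral.integral_of_le zero_le_one, ← div_self hNpos.ne',
      intervalIntegral_comp_ceil hNpos (fun l => iidUniform.real {ω | G (l, ω) = s}),
      Finset.sum_congr rfl hterm]
    split_ifs with hs
    · rw [← Finset.sum_mul, ← mul_assoc]
      -- summed over the value `l` of the first piece, the factors `l * c_l` add up to `N`
      have hsum : ∑ l ∈ Finset.Icc 1 N, ((l : ℝ) * s.count l) = N := by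
        have h1 : ∑ l ∈ s.toFinset, s.count l * l = N := by
          rw [← hs.1, Finset.sum_multiset_count]
          simp
        have hsub : s.toFinset ⊆ Finset.Icc 1 N := by
          intro l hl
          rw [Multiset.mem_toFinset] at hl
          rw [Finset.mem_Icc]
          exact ⟨Nat.one_le_iff_ne_zero.2 fun h => hs.2 (h ▸ hl),
            hs.1 ▸ Multiset.le_sum_of_mem hl⟩
        rw [← Finset.sum_subset hsub (fun l _ hl => by
          rw [Multiset.mem_toFinset] at hl
          simp [Multiset.count_eq_zero_of_notMem hl])]
        rw [← h1]
        push_cast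
        exact Finset.sum_congr rfl fun l _ => mul_comm _ _
      rw [hsum, inv_mul_cancel₀ hNpos.ne', one_mul]
    · simp

/-- The expectation of a function of a uniformly random element of a finite type is an average. -/
theorem integral_uniformOfFintype_map {β γ : Type*} [Fintype β] [Nonempty β] [MeasurableSpace γ]
    (f : β → γ) {φ : γ → ℝ} (hφ : Measurable φ) :
    ∫ x, φ x ∂((PMF.uniformOfFintype β).map f).toMeasure
      = (Fintype.card β : ℝ)⁻¹ * ∑ b, φ (f b) := by
  let _ : MeasurableSpace β := ⊤
  have : DiscreteMeasurableSpace β := ⟨fun _ => trivial⟩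
  rw [← PMF.toMeasure_map f _ Measurable.of_discrete, integral_map
    Measurable.of_discrete.aemeasurable hφ.aestronglyMeasurable, PMF.integral_eq_sum]
  simp [Finset.mul_sum]

/-- The cycle lengths of a uniformly random permutation of an `N`-element set are distributed as
the pieces of a stick of length `N`. -/
theorem sum_cycleMultiset_perm (α : Type*) [Fintype α] [DecidableEq α] (F : Multiset ℕ → ℝ) :
    (Fintype.card (Equiv.Perm α) : ℝ)⁻¹ * ∑ π : Equiv.Perm α, F (cycleMultiset π)
      = ∫ ω, F (pieces (Fintype.card α) (Fintype.card α) ω) ∂iidUniform := by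
  have hlaw : ((PMF.uniformOfFintype (Equiv.Perm α)).map
      fun π : Equiv.Perm α => cycleMultiset π).toMeasure
      = iidUniform.map (pieces (Fintype.card α) (Fintype.card α)) := by
    have := Measure.isProbabilityMeasure_map
      (measurable_pieces (Fintype.card α) (Fintype.card α)).aemeasurable (μ := iidUniform)
    refine Measure.ext_of_singleton fun s => ?_
    rw [← measureReal_eq_measureReal_iff,
      map_measureReal_apply (measurable_pieces _ _) .of_discrete]
    change _ = iidUniform.real {ω | _ = s}
    have h1 := integral_uniformOfFintype_map (fun π : Equiv.Perm α => cycleMultiset π)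
      (φ := ({s} : Set (Multiset ℕ)).indicator fun _ => (1 : ℝ)) Measurable.of_discrete
    rw [integral_indicator_const _ (measurableSet_singleton s), smul_eq_mul, mul_one] at h1
    rw [h1, iidUniform_real_pieces_eq _ le_rfl s]
    have h2 := card_perm_cycleMultiset α s
    simp only [Set.indicator_apply, mem_singleton_iff, Finset.sum_boole, h2, Fintype.card_perm]
    have : ((Fintype.card α).factorial : ℝ) ≠ 0 := by positivity
    split_ifs
    · field_simp
    · simp
  rw [← integral_uniformOfFintype_map _ Measurable.of_discrete, hlaw,
    integral_map (measurable_pieces _ _).aemeasurable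
      Measurable.of_discrete.aestronglyMeasurable]

/-! ### Almost sure convergence of the longest pieces -/

theorem lt_getD_iff_of_pairwise {L : List ℕ} (hL : L.Pairwise (· ≥ ·)) (a i : ℕ) :
    a < L.getD i 0 ↔ i < (L.filter (a < ·)).length := by
  induction L generalizing i with
  | nil => simp
  | cons x L ih =>
    rw [List.pairwise_cons] at hL
    by_cases hx : a < x
    · rw [List.filter_cons_of_pos (by simpa using hx)]
      cases i with
      | zero => simpa using hx
      | succ i => simpa using ih hL.2 i
    · have hnil : L.filter (a < ·) = [] := by
        rw [List.filter_eq_nil_iff]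
        intro b hb
        have := hL.1 b hb
        simp only [decide_eq_true_eq]
        omega
      rw [List.filter_cons_of_neg (by simpa using hx), hnil]
      cases i with
      | zero => simpa using hx
      | succ i => simpa [hnil] using ih hL.2 i

theorem lt_kthLargest_iff (s : Multiset ℕ) (a j : ℕ) :
    a < kthLargest s (j + 1) ↔ j + 1 ≤ (s.filter (a < ·)).card := by
  rw [kthLargest, Nat.add_sub_cancel, lt_getD_iff_of_pairwise (Multiset.pairwise_sort s _),
    Nat.lt_iff_add_one_le, ← Multiset.coe_card, ← Multiset.filter_coe, Multiset.sort_eq]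

theorem remainder_le (N : ℕ) {ω : ℕ → ℝ} (hω : ∀ i, ω i ∈ Ioo (0 : ℝ) 1) (m : ℕ) :
    remainder N ω m ≤ N - m := by
  induction m generalizing N ω with
  | zero => exact le_rfl
  | succ m ih =>
    rcases eq_or_ne N 0 with rfl | hN
    · rw [remainder_zero]
      exact Nat.zero_le _
    · have h1 := ih (N - ⌈ω 0 * N⌉₊) (ω := shift ω) fun i => hω (i + 1)
      have h2 := Finset.mem_Icc.1 (ceil_mul_mem_Icc hN (Ioo_subset_Ioc_self (hω 0)))
      rw [remainder]
      omega

theorem remainder_succ_le (N : ℕ) (ω : ℕ → ℝ) (m : ℕ) :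
    remainder N ω (m + 1) ≤ remainder N ω m := by
  induction m generalizing N ω with
  | zero => exact Nat.sub_le _ _
  | succ m ih => exact ih _ _

/-- The `j`-th longest piece has length more than `c` if and only if there are `j` pieces longer
than `c`. -/
theorem lt_kthLargest_pieces_iff (N : ℕ) {ω : ℕ → ℝ} (hω : ∀ i, ω i ∈ Ioo (0 : ℝ) 1) {c : ℝ}
    (hc : 0 ≤ c) (j : ℕ) :
    c < kthLargest (pieces N N ω) (j + 1)
      ↔ ∃ T : Finset ℕ, T.card = j + 1 ∧ ∀ i ∈ T, c < piece N ω i := by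
  simp only [← Nat.floor_lt hc]
  rw [lt_kthLargest_iff]
  have hcard : ((pieces N N ω).filter (⌊c⌋₊ < ·)).card
      = ((Finset.range N).filter fun i => ⌊c⌋₊ < piece N ω i).card := by
    rw [pieces, Multiset.filter_filter, Multiset.filter_map, Multiset.card_map, Finset.card,
      Finset.filter_val, Finset.range_val]
    congr 1
    refine Multiset.filter_congr fun i _ => ?_
    simp only [Function.comp]
    omega
  rw [hcard, Finset.le_card_iff_exists_subset_card]
  constructor
  · rintro ⟨T, hT, hTc⟩
    exact ⟨T, hTc, fun i hi => (Finset.mem_filter.1 (hT hi)).2⟩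
  · rintro ⟨T, hTc, hT⟩
    refine ⟨T, fun i hi => Finset.mem_filter.2 ⟨?_, hT i hi⟩, hTc⟩
    have h1 := hT i hi
    have h2 := remainder_le N hω i
    rw [piece] at h1
    rw [Finset.mem_range]
    omega

/-- The normalized `j`-th longest piece is a `1`-Lipschitz function of the normalized pieces in
the supremum norm. -/
theorem kthLargest_pieces_div_le {N M : ℕ} (hN : N ≠ 0) (hM : M ≠ 0) {ω : ℕ → ℝ}
    (hω : ∀ i, ω i ∈ Ioo (0 : ℝ) 1) {ε : ℝ} (hε : 0 ≤ ε)
    (h : ∀ i, (piece N ω i : ℝ) / N ≤ piece M ω i / M + ε) (j : ℕ) :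
    (kthLargest (pieces N N ω) (j + 1) : ℝ) / N
      ≤ kthLargest (pieces M M ω) (j + 1) / M + ε := by
  have hN' : (0 : ℝ) < N := by positivity
  have hM' : (0 : ℝ) < M := by positivity
  by_contra! hcon
  rw [lt_div_iff₀ hN', lt_kthLargest_pieces_iff N hω (by positivity)] at hcon
  obtain ⟨T, hT, hTc⟩ := hcon
  refine lt_irrefl (kthLargest (pieces M M ω) (j + 1) : ℝ)
    ((lt_kthLargest_pieces_iff M hω (Nat.cast_nonneg _) j).2 ⟨T, hT, fun i hi => ?_⟩)
  have h1 := hTc i hi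
  rw [← lt_div_iff₀ hN'] at h1
  have h2 : (kthLargest (pieces M M ω) (j + 1) : ℝ) / M < piece M ω i / M := by linarith [h i]
  exact (div_lt_div_iff_of_pos_right hM').1 h2

/-- The proportion of the stick that remains after `m` pieces have been broken off, in the limit
of a long stick. -/
noncomputable def remainingFraction : (ℕ → ℝ) → ℕ → ℝ
  | _, 0 => 1
  | ω, m + 1 => (1 - ω 0) * remainingFraction (shift ω) m

theorem remainingFraction_mem {ω : ℕ → ℝ} (hω : ∀ i, ω i ∈ Ioo (0 : ℝ) 1) (m : ℕ) :
    remainingFraction ω m ∈ Ioc (0 : ℝ) 1 := by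
  induction m generalizing ω with
  | zero => simp [remainingFraction]
  | succ m ih =>
    have h1 := ih (ω := shift ω) fun i => hω (i + 1)
    have h2 := hω 0
    rw [remainingFraction]
    exact ⟨mul_pos (by linarith [h2.2]) h1.1,
      mul_le_one₀ (by linarith [h2.1]) h1.1.le h1.2⟩

theorem remainingFraction_succ_lt {ω : ℕ → ℝ} (hω : ∀ i, ω i ∈ Ioo (0 : ℝ) 1) (m : ℕ) :
    remainingFraction ω (m + 1) < remainingFraction ω m := by
  induction m generalizing ω with
  | zero =>
    simp only [remainingFraction]
    linarith [(hω 0).1]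
  | succ m ih =>
    have h1 := ih (ω := shift ω) fun i => hω (i + 1)
    exact mul_lt_mul_of_pos_left h1 (by linarith [(hω 0).2])

/-- Each rounding up costs at most `1`, and later steps only shrink this error. -/
theorem abs_remainder_sub_le (N : ℕ) {ω : ℕ → ℝ} (hω : ∀ i, ω i ∈ Ioo (0 : ℝ) 1) (m : ℕ) :
    |(remainder N ω m : ℝ) - remainingFraction ω m * N| ≤ m := by
  induction m generalizing N ω with
  | zero => simp [remainder, remainingFraction]
  | succ m ih =>
    have hsh : ∀ i, shift ω i ∈ Ioo (0 : ℝ) 1 := fun i => hω (i + 1)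
    have h1 := ih (N - ⌈ω 0 * N⌉₊) hsh
    have hρ := remainingFraction_mem hsh m
    have hle : ⌈ω 0 * N⌉₊ ≤ N := by
      rw [Nat.ceil_le]
      exact mul_le_of_le_one_left (Nat.cast_nonneg _) (hω 0).2.le
    have h2 := Nat.le_ceil (ω 0 * N)
    have h3 := (Nat.ceil_lt_add_one (mul_nonneg (hω 0).1.le (Nat.cast_nonneg N))).le
    rw [remainder, remainingFraction]
    rw [Nat.cast_sub hle] at h1
    push_cast
    set ρ := remainingFraction (shift ω) m
    set l : ℝ := (⌈ω 0 * N⌉₊ : ℝ)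
    have h4 : ρ * (l - ω 0 * N) ≤ 1 := by
      have : ρ * (l - ω 0 * N) ≤ 1 * 1 :=
        mul_le_mul hρ.2 (by linarith) (by linarith) zero_le_one
      linarith
    have h5 : 0 ≤ ρ * (l - ω 0 * N) := mul_nonneg hρ.1.le (by linarith)
    rw [abs_le] at h1 ⊢
    constructor <;> nlinarith [h1.1, h1.2]

theorem measurable_remainingFraction (m : ℕ) :
    Measurable fun ω => remainingFraction ω m := by
  induction m with
  | zero => exact measurable_const
  | succ m ih =>
    exact (measurable_const.sub (measurable_pi_apply 0)).mul (ih.comp measurable_shift)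

/-- Each step halves the remaining fraction on average. -/
theorem lintegral_remainingFraction (m : ℕ) :
    ∫⁻ ω, ENNReal.ofReal (remainingFraction ω m) ∂iidUniform = 2⁻¹ ^ m := by
  induction m with
  | zero => simp [remainingFraction]
  | succ m ih =>
    have h1 : ∫⁻ ω, ENNReal.ofReal (remainingFraction ω (m + 1)) ∂iidUniform
        = ∫⁻ ω, (fun p : ℝ × (ℕ → ℝ) => ENNReal.ofReal (1 - p.1)
          * ENNReal.ofReal (remainingFraction p.2 m)) (ω 0, shift ω) ∂iidUniform := by
      refine lintegral_congr_ae ?_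
      filter_upwards [ae_mem_Ioo_iidUniform] with ω hω
      rw [remainingFraction, ENNReal.ofReal_mul (by linarith [(hω 0).2])]
    have hm := (measurable_remainingFraction m).ennreal_ofReal
    have h2 : ∫⁻ u, ENNReal.ofReal (1 - u) ∂uniformUnit = 2⁻¹ := by
      rw [uniformUnit, ← ofReal_integral_eq_lintegral_ofReal]
      · rw [← intervalIntegral.integral_of_le zero_le_one]
        have h3 : ∫ u in (0 : ℝ)..1, (1 - u) = 2⁻¹ := by
          rw [intervalIntegral.integral_sub (by simp) (by simp)]
          norm_num [integral_id]
        rw [h3, ENNReal.ofReal_inv_of_pos two_pos]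
        norm_num
      · exact (continuous_const.sub continuous_id).integrableOn_Icc.mono_set Ioc_subset_Icc_self
      · filter_upwards [ae_restrict_mem measurableSet_Ioc] with u hu
        simpa using hu.2
    have hfm : Measurable fun p : ℝ × (ℕ → ℝ) => ENNReal.ofReal (1 - p.1)
        * ENNReal.ofReal (remainingFraction p.2 m) :=
      (measurable_const.sub measurable_fst).ennreal_ofReal.mul (hm.comp measurable_snd)
    rw [h1, measurePreserving_head_shift.lintegral_comp hfm, lintegral_prod_mul
      (f := fun u => ENNReal.ofReal (1 - u)) (g := fun ω => ENNReal.ofReal (remainingFraction ω m))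
      (by fun_prop) hm.aemeasurable, h2, ih, pow_succ']

/-- The remaining fractions have a finite expected sum, so almost surely they tend to `0`. -/
theorem ae_tendsto_remainingFraction :
    ∀ᵐ ω ∂iidUniform, Tendsto (remainingFraction ω) atTop (𝓝 0) := by
  have h : ∫⁻ ω, ∑' m, ENNReal.ofReal (remainingFraction ω m) ∂iidUniform ≠ ⊤ := by
    rw [lintegral_tsum fun m => (measurable_remainingFraction m).ennreal_ofReal.aemeasurable]
    simp [lintegral_remainingFraction, ENNReal.tsum_geometric]
  filter_upwards [ae_lt_top' (AEMeasurable.tsum fun m =>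
    (measurable_remainingFraction m).ennreal_ofReal.aemeasurable) h, ae_mem_Ioo_iidUniform]
    with ω hω hω'
  have h1 := ENNReal.tendsto_atTop_zero_of_tsum_ne_top hω.ne
  have h2 := (ENNReal.tendsto_toReal ENNReal.zero_ne_top).comp h1
  refine h2.congr fun m => ?_
  exact ENNReal.toReal_ofReal (remainingFraction_mem hω' m).1.le

theorem abs_piece_div_sub_le {N : ℕ} (hN : N ≠ 0) {ω : ℕ → ℝ}
    (hω : ∀ i, ω i ∈ Ioo (0 : ℝ) 1) (i : ℕ) :
    |(piece N ω i : ℝ) / N - (remainingFraction ω i - remainingFraction ω (i + 1))|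
      ≤ (2 * i + 1) / N := by
  have hN' : (0 : ℝ) < N := by positivity
  have h1 := abs_remainder_sub_le N hω i
  have h2 := abs_remainder_sub_le N hω (i + 1)
  rw [piece, Nat.cast_sub (remainder_succ_le N ω i)]
  rw [show ((remainder N ω i : ℝ) - remainder N ω (i + 1)) / N
      - (remainingFraction ω i - remainingFraction ω (i + 1))
      = ((remainder N ω i - remainingFraction ω i * N)
        - (remainder N ω (i + 1) - remainingFraction ω (i + 1) * N)) / N by field_simp; ring,
    abs_div, abs_of_pos hN']
  gcongr
  refine (abs_sub _ _).trans ?_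
  push_cast at h2
  linarith

theorem piece_div_le {N m i : ℕ} (hN : N ≠ 0) {ω : ℕ → ℝ}
    (hω : ∀ i, ω i ∈ Ioo (0 : ℝ) 1) (hmi : m ≤ i) :
    (piece N ω i : ℝ) / N ≤ remainingFraction ω m + m / N := by
  have hN' : (0 : ℝ) < N := by positivity
  have h1 : piece N ω i ≤ remainder N ω m :=
    (Nat.sub_le _ _).trans (antitone_nat_of_succ_le (remainder_succ_le N ω) hmi)
  have h2 := (abs_le.1 (abs_remainder_sub_le N hω m)).2
  have h3 : (piece N ω i : ℝ) ≤ remainder N ω m := by exact_mod_cast h1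
  rw [div_le_iff₀ hN', add_mul, div_mul_cancel₀ _ hN'.ne']
  linarith

/-- The normalized `j`-th longest piece converges when the length of the stick grows, for a fixed
sequence of breaking points. -/
theorem cauchySeq_kthLargest_pieces {ω : ℕ → ℝ} (hω : ∀ i, ω i ∈ Ioo (0 : ℝ) 1)
    (hρ : Tendsto (remainingFraction ω) atTop (𝓝 0)) (j : ℕ) :
    CauchySeq fun N : ℕ => (kthLargest (pieces N N ω) (j + 1) : ℝ) / N := by
  rw [Metric.cauchySeq_iff]
  intro ε hε
  -- the pieces from the `m`-th on are uniformly small; the first `m` converge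
  obtain ⟨m, hm⟩ := (hρ.eventually_lt_const (show (0 : ℝ) < ε / 4 by positivity)).exists
  obtain ⟨N₀, hN₀⟩ := exists_nat_gt ((2 * m + 1) / (ε / 4))
  have hle : ∀ N ≥ N₀ + 1, (2 * m + 1 : ℝ) / N ≤ ε / 4 := by
    intro N hN
    have : (N₀ : ℝ) + 1 ≤ N := by exact_mod_cast hN
    rw [div_lt_iff₀ (by positivity)] at hN₀
    rw [div_le_iff₀ (by linarith [(Nat.cast_nonneg N₀ : (0 : ℝ) ≤ N₀)])]
    nlinarith
  have hcomp : ∀ N ≥ N₀ + 1, ∀ M ≥ N₀ + 1, ∀ i,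
      (piece N ω i : ℝ) / N ≤ piece M ω i / M + ε / 2 := by
    intro N hN M hM i
    rcases lt_or_ge i m with him | hmi
    · have hmono : ∀ K : ℕ, (2 * i + 1 : ℝ) / K ≤ (2 * m + 1) / K := fun K => by gcongr
      have h1 := (abs_le.1 (abs_piece_div_sub_le (N := N) (by omega) hω i)).2
      have h2 := (abs_le.1 (abs_piece_div_sub_le (N := M) (by omega) hω i)).1
      linarith [hmono N, hmono M, hle N hN, hle M hM]
    · have h1 := piece_div_le (N := N) (by omega) hω hmi
      have h2 : (m : ℝ) / N ≤ (2 * m + 1) / N := by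
        gcongr
        linarith [(Nat.cast_nonneg m : (0 : ℝ) ≤ m)]
      have h3 : (0 : ℝ) ≤ piece M ω i / M := by positivity
      linarith [hle N hN]
  refine ⟨N₀ + 1, fun N hN M hM => ?_⟩
  have h1 := kthLargest_pieces_div_le (N := N) (M := M) (by omega) (by omega) hω
    (by positivity) (hcomp N hN M hM) j
  have h2 := kthLargest_pieces_div_le (N := M) (M := N) (by omega) (by omega) hω
    (by positivity) (hcomp M hM N hN) j
  rw [Real.dist_eq, abs_lt]
  constructor <;> linarith

/-- The first `j` pieces are asymptotically positive fractions of the stick, hence so is the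
`j`-th longest one. -/
theorem pos_of_tendsto_kthLargest_pieces {ω : ℕ → ℝ} (hω : ∀ i, ω i ∈ Ioo (0 : ℝ) 1) {j : ℕ}
    {x : ℝ} (hx : Tendsto (fun N : ℕ => (kthLargest (pieces N N ω) (j + 1) : ℝ) / N) atTop (𝓝 x)) :
    0 < x := by
  obtain ⟨i₀, -, hi₀⟩ := (Finset.range (j + 1)).exists_min_image
    (fun i => remainingFraction ω i - remainingFraction ω (i + 1)) ⟨0, by simp⟩
  set δ := remainingFraction ω i₀ - remainingFraction ω (i₀ + 1) with hδ
  have hδ0 : 0 < δ := sub_pos.2 (remainingFraction_succ_lt hω i₀)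
  have hlim : Tendsto (fun N : ℕ => (2 * (j + 1) : ℝ) / N) atTop (𝓝 0) :=
    tendsto_const_div_atTop_nhds_zero_nat _
  refine (half_pos hδ0).trans_le (ge_of_tendsto hx ?_)
  filter_upwards [hlim.eventually_lt_const (half_pos hδ0), eventually_gt_atTop 0] with N hN hN0
  have hN' : (0 : ℝ) < N := by exact_mod_cast hN0
  rw [le_div_iff₀ hN']
  refine ((lt_kthLargest_pieces_iff N hω (by positivity) j).2
    ⟨Finset.range (j + 1), Finset.card_range _, fun i hi => ?_⟩).le
  rw [← lt_div_iff₀ hN']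
  have h1 := (abs_le.1 (abs_piece_div_sub_le (N := N) (by omega) hω i)).1
  have h2 := hi₀ i hi
  have h3 : (2 * i + 1 : ℝ) / N ≤ (2 * (j + 1)) / N := by
    have : (i : ℝ) + 1 ≤ j + 1 := by exact_mod_cast Finset.mem_range.1 hi
    gcongr
    linarith
  linarith

/-- The vector of the `k` longest pieces of a stick of length `N`, divided by `N`. -/
noncomputable def longestPieces (k N : ℕ) (ω : ℕ → ℝ) : Fin k → ℝ :=
  fun i => (N : ℝ)⁻¹ * kthLargest (pieces N N ω) (i + 1)

theorem measurable_longestPieces (k N : ℕ) : Measurable (longestPieces k N) := by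
  rw [measurable_pi_iff]
  intro i
  exact measurable_const.mul ((Measurable.of_discrete
    (f := fun s : Multiset ℕ => (kthLargest s (i + 1) : ℝ))).comp (measurable_pieces N N))

/-- The coordinates of the limit `X` have the Poisson–Dirichlet law, but only their positivity is
needed. -/
theorem exists_tendsto_longestPieces (k : ℕ) :
    ∃ X : (ℕ → ℝ) → Fin k → ℝ, Measurable X ∧
      (∀ᵐ ω ∂iidUniform, Tendsto (fun N => longestPieces k N ω) atTop (𝓝 (X ω))) ∧
      ∀ᵐ ω ∂iidUniform, ∀ i, 0 < X ω i := by
  have hconv : ∀ᵐ ω ∂iidUniform, ∃ x, Tendsto (fun N => longestPieces k N ω) atTop (𝓝 x) := by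
    filter_upwards [ae_mem_Ioo_iidUniform, ae_tendsto_remainingFraction] with ω hω hρ
    choose x hx using fun i : Fin k =>
      cauchySeq_tendsto_of_complete (cauchySeq_kthLargest_pieces hω hρ i)
    refine ⟨x, tendsto_pi_nhds.2 fun i => (hx i).congr fun N => ?_⟩
    rw [longestPieces, div_eq_inv_mul]
  obtain ⟨X, hXm, hX⟩ := measurable_limit_of_tendsto_metrizable_ae
    (fun N => (measurable_longestPieces k N).aemeasurable) hconv
  refine ⟨X, hXm, hX, ?_⟩
  filter_upwards [ae_mem_Ioo_iidUniform, hX] with ω hω hlim i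
  refine pos_of_tendsto_kthLargest_pieces hω (j := i) ((tendsto_pi_nhds.1 hlim i).congr fun N => ?_)
  rw [longestPieces, div_eq_inv_mul]

/-! ### The number of periodic points -/

/-- The probability that a uniformly random self-map of an `N`-element set has exactly `m`
periodic points. -/
noncomputable def cyclicProb (N m : ℕ) : ℝ :=
  (m / N : ℝ) * ∏ i ∈ Finset.range m, (1 - (i : ℝ) / N)

theorem cyclicProb_eq_zero {N m : ℕ} (hN : N ≠ 0) (h : N < m) : cyclicProb N m = 0 := by
  rw [cyclicProb, Finset.prod_eq_zero (Finset.mem_range.2 h), mul_zero]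
  rw [div_self (by positivity), sub_self]

/-- There are `N.choose m` sets of `m` periodic points, `m !` permutations of each, and
`m N ^ (N - m) / N` forests rooted at it, among `N ^ N` maps. -/
theorem cyclicProb_eq {N m : ℕ} (hN : N ≠ 0) (hm : m ≤ N) :
    cyclicProb N m
      = ((N : ℝ) ^ N)⁻¹ * (N.choose m * ((m * (N : ℝ) ^ (N - m) / N) * m.factorial)) := by
  have hN' : (N : ℝ) ≠ 0 := by positivity
  have h1 : ∏ i ∈ Finset.range m, (1 - (i : ℝ) / N) = (m.factorial * N.choose m) / (N : ℝ) ^ m := by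
    rw [← Nat.cast_mul, ← Nat.descFactorial_eq_factorial_mul_choose,
      Nat.descFactorial_eq_prod_range,
      Nat.cast_prod]
    nth_rewrite 3 [← Finset.card_range m]
    rw [← Finset.prod_const, ← Finset.prod_div_distrib]
    refine Finset.prod_congr rfl fun i hi => ?_
    rw [Nat.cast_sub ((Finset.mem_range.1 hi).le.trans hm)]
    field_simp
  have h2 : (N : ℝ) ^ N = (N : ℝ) ^ (N - m) * (N : ℝ) ^ m := by
    rw [← pow_add, Nat.sub_add_cancel hm]
  rw [cyclicProb, h1, h2]
  field_simp

/-- The cycle lengths of a uniformly random self-map of an `N`-element set are those of a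
uniformly random permutation of a set whose size is the random number of periodic points. -/
theorem sum_cycleMultiset_eq_sum_cyclicProb {N : ℕ} (hN : N ≠ 0) (F : Multiset ℕ → ℝ) :
    (Fintype.card (Fin N → Fin N) : ℝ)⁻¹ * ∑ g : Fin N → Fin N, F (cycleMultiset g)
      = ∑ m ∈ Finset.Icc 1 N, cyclicProb N m * ∫ ω, F (pieces m m ω) ∂iidUniform := by
  have hN' : (N : ℝ) ≠ 0 := by positivity
  set f : ℕ → ℝ := fun m =>
    (m * (N : ℝ) ^ (N - m) / N) * (m.factorial * ∫ ω, F (pieces m m ω) ∂iidUniform) with hf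
  have hterm : ∀ S : Finset (Fin N), ((rootedForests S).card : ℝ)
      * ∑ π : Equiv.Perm S, F (cycleMultiset π) = f S.card := by
    intro S
    have h1 := sum_cycleMultiset_perm S F
    rw [Fintype.card_perm, Fintype.card_coe, inv_mul_eq_iff_eq_mul₀ (by positivity)] at h1
    have h2 : ((rootedForests S).card : ℝ) * N = S.card * (N : ℝ) ^ (N - S.card) := by
      have := card_rootedForests S
      rw [Fintype.card_fin] at this
      exact_mod_cast this
    rw [h1, hf]
    dsimp only
    rw [← h2, mul_div_cancel_right₀ _ hN']
  rw [sum_cycleMultiset_selfMap, Finset.sum_congr rfl fun S _ => hterm S, ← Finset.powerset_univ,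
    Finset.sum_powerset_apply_card, Finset.card_univ, Fintype.card_fin, Fintype.card_fun,
    Fintype.card_fin, Finset.mul_sum, Finset.range_eq_Ico,
    Finset.sum_eq_sum_Ico_succ_bot (by omega)]
  have h0 : f 0 = 0 := by simp [hf]
  rw [h0, smul_zero, mul_zero, zero_add]
  refine Finset.sum_congr rfl fun m hm => ?_
  have := Finset.mem_Ico.1 hm
  rw [cyclicProb_eq hN (by omega), hf, nsmul_eq_mul]
  push_cast
  ring

theorem integral_randomPermutationLaw (k N : ℕ) {φ : (Fin k → ℝ) → ℝ} (hφ : Measurable φ) :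
    ∫ x, φ x ∂(randomPermutationLaw k N : Measure (Fin k → ℝ))
      = ∫ ω, φ (longestPieces k N ω) ∂iidUniform := by
  have h := sum_cycleMultiset_perm (Fin N)
    (fun s => φ fun i : Fin k => (N : ℝ)⁻¹ * kthLargest s (i + 1))
  rw [Fintype.card_fin] at h
  exact (integral_uniformOfFintype_map (fun σ : Equiv.Perm (Fin N) =>
    scaledCycleVector (N : ℝ)⁻¹ k σ) hφ).trans h

theorem integral_randomMappingLaw (k : ℕ) {N : ℕ} (hN : N ≠ 0) {φ : (Fin k → ℝ) → ℝ}
    (hφ : Measurable φ) :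
    ∫ x, φ x ∂(randomMappingLaw k N : Measure (Fin k → ℝ))
      = ∑ m ∈ Finset.Icc 1 N, cyclicProb N m
        * ∫ ω, φ ((m / √N : ℝ) • longestPieces k m ω) ∂iidUniform := by
  have h := sum_cycleMultiset_eq_sum_cyclicProb hN
    (fun s => φ fun i : Fin k => (√N)⁻¹ * kthLargest s (i + 1))
  refine ((integral_uniformOfFintype_map (fun g : Fin N → Fin N =>
    scaledCycleVector (√N)⁻¹ k g) hφ).trans h).trans ?_
  refine Finset.sum_congr rfl fun m hm => ?_
  have hm' : (m : ℝ) ≠ 0 := by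
    have := (Finset.mem_Icc.1 hm).1
    positivity
  congr 2
  funext ω
  congr 1
  funext i
  simp only [longestPieces, Pi.smul_apply, smul_eq_mul]
  field_simp

theorem sum_range_cast (m : ℕ) : ∑ i ∈ Finset.range m, (i : ℝ) = m * (m - 1) / 2 := by
  induction m with
  | zero => simp
  | succ m ih =>
    rw [Finset.sum_range_succ, ih]
    push_cast
    ring

theorem prod_one_sub_div_le {N m : ℕ} (hm : m ≤ N) :
    ∏ i ∈ Finset.range m, (1 - (i : ℝ) / N) ≤ Real.exp (-(m * (m - 1) / 2 / N)) := by
  have h1 : -((m : ℝ) * (m - 1) / 2 / N) = ∑ i ∈ Finset.range m, -((i : ℝ) / N) := by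
    rw [← sum_range_cast, Finset.sum_div, Finset.sum_neg_distrib]
  rw [h1, Real.exp_sum]
  refine Finset.prod_le_prod (fun i hi => ?_) fun i _ => ?_
  · have : (i : ℝ) ≤ N := by exact_mod_cast (Finset.mem_range.1 hi).le.trans hm
    exact sub_nonneg.2 (div_le_one_of_le₀ this (Nat.cast_nonneg N))
  · linarith [Real.add_one_le_exp (-((i : ℝ) / N))]

/-- The lower bound of the birthday product, from `1 - x ≥ exp (-x / (1 - x))`. -/
theorem le_prod_one_sub_div {N m : ℕ} (hm : m < N) :
    Real.exp (-(m * (m - 1) / 2 / (N - m))) ≤ ∏ i ∈ Finset.range m, (1 - (i : ℝ) / N) := by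
  have hm' : (m : ℝ) < N := by exact_mod_cast hm
  have hN : (0 : ℝ) < N := (Nat.cast_nonneg m).trans_lt hm'
  have h1 : -((m : ℝ) * (m - 1) / 2 / (N - m)) = ∑ i ∈ Finset.range m, -((i : ℝ) / (N - m)) := by
    rw [← sum_range_cast, Finset.sum_div, Finset.sum_neg_distrib]
  rw [h1, Real.exp_sum]
  refine Finset.prod_le_prod (fun i _ => (Real.exp_pos _).le) fun i hi => ?_
  have hi' : (i : ℝ) < m := by exact_mod_cast Finset.mem_range.1 hi
  have hpos : 0 < 1 - (i : ℝ) / N := by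
    rw [sub_pos, div_lt_one hN]
    linarith
  rw [← Real.le_log_iff_exp_le hpos]
  refine le_trans ?_ (Real.one_sub_inv_le_log_of_pos hpos)
  have h2 : 1 - (1 - (i : ℝ) / N)⁻¹ = -(i / (N - i)) := by
    have : (N : ℝ) - i ≠ 0 := by linarith
    field_simp
    ring
  rw [h2, neg_le_neg_iff]
  gcongr

theorem tendsto_sqrt_natCast : Tendsto (fun N : ℕ => √(N : ℝ)) atTop atTop :=
  Real.tendsto_sqrt_atTop.comp tendsto_natCast_atTop_atTop

theorem tendsto_ceil_mul_sqrt_div {r : ℝ} (hr : 0 < r) :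
    Tendsto (fun N : ℕ => (⌈r * √(N : ℝ)⌉₊ : ℝ) / √N) atTop (𝓝 r) :=
  (tendsto_nat_ceil_mul_div_atTop hr.le).comp tendsto_sqrt_natCast

theorem tendsto_ceil_mul_sqrt {r : ℝ} (hr : 0 < r) :
    Tendsto (fun N : ℕ => ⌈r * √(N : ℝ)⌉₊) atTop atTop :=
  tendsto_nat_ceil_atTop.comp (tendsto_sqrt_natCast.const_mul_atTop hr)

/-- The birthday estimate: the number of periodic points, divided by `√N`, has a density that
converges to the Rayleigh density. -/
theorem tendsto_sqrt_mul_cyclicProb {r : ℝ} (hr : 0 < r) :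
    Tendsto (fun N : ℕ => √(N : ℝ) * cyclicProb N ⌈r * √(N : ℝ)⌉₊) atTop
      (𝓝 (r * Real.exp (-r ^ 2 / 2))) := by
  set m : ℕ → ℕ := fun N => ⌈r * √(N : ℝ)⌉₊ with hm
  have h1 : Tendsto (fun N : ℕ => (m N : ℝ) / √N) atTop (𝓝 r) := tendsto_ceil_mul_sqrt_div hr
  have h2 : Tendsto (fun N : ℕ => (√(N : ℝ))⁻¹) atTop (𝓝 0) :=
    tendsto_inv_atTop_zero.comp tendsto_sqrt_natCast
  have hsq : ∀ N : ℕ, √(N : ℝ) * √N = N := fun N => Real.mul_self_sqrt (Nat.cast_nonneg N)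
  have h3 : Tendsto (fun N : ℕ => (m N : ℝ) / N) atTop (𝓝 0) := by
    have := h1.mul h2
    rw [mul_zero] at this
    refine this.congr fun N => ?_
    rw [← div_eq_mul_inv, div_div, hsq]
  have h4 : Tendsto (fun N : ℕ => (m N * (m N - 1) / 2 / N : ℝ)) atTop (𝓝 (r ^ 2 / 2)) := by
    have h5 : Tendsto (fun N : ℕ => ((m N : ℝ) / √N) * (m N / √N) / 2 - m N / N / 2) atTop
        (𝓝 (r * r / 2 - 0 / 2)) := ((h1.mul h1).div_const 2).sub (h3.div_const 2)
    rw [zero_div, sub_zero, ← sq] at h5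
    refine h5.congr fun N => ?_
    rw [div_mul_div_comm, hsq]
    ring
  have h6 : ∀ᶠ N : ℕ in atTop, m N < N := by
    filter_upwards [h3.eventually_lt_const one_pos, eventually_gt_atTop 0] with N hN hN0
    rw [div_lt_one (by exact_mod_cast hN0)] at hN
    exact_mod_cast hN
  have h7 : Tendsto (fun N : ℕ => (m N * (m N - 1) / 2 / (N - m N) : ℝ)) atTop
      (𝓝 (r ^ 2 / 2)) := by
    have h8 := h4.div (tendsto_const_nhds.sub h3 : Tendsto (fun N : ℕ => (1 : ℝ) - m N / N) atTop
      (𝓝 (1 - 0))) (by norm_num)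
    rw [sub_zero, div_one] at h8
    refine h8.congr' ?_
    filter_upwards [eventually_gt_atTop 0] with N hN
    have : (N : ℝ) ≠ 0 := by positivity
    simp only [Pi.div_apply]
    rw [div_div, mul_sub (N : ℝ), mul_one, mul_div_cancel₀ _ this]
  have h9 : Tendsto (fun N : ℕ => ∏ i ∈ Finset.range (m N), (1 - (i : ℝ) / N)) atTop
      (𝓝 (Real.exp (-(r ^ 2 / 2)))) := by
    refine tendsto_of_tendsto_of_tendsto_of_le_of_le'
      ((Real.continuous_exp.tendsto _).comp h7.neg) ((Real.continuous_exp.tendsto _).comp h4.neg)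
      ?_ ?_
    · filter_upwards [h6] with N hN using le_prod_one_sub_div hN
    · filter_upwards [h6] with N hN using prod_one_sub_div_le hN.le
  rw [neg_div]
  refine (h1.mul h9).congr fun N => ?_
  rw [cyclicProb, ← mul_assoc]
  congr 1
  rcases eq_or_ne N 0 with rfl | hN
  · simp
  · have : √(N : ℝ) ≠ 0 := by positivity
    change (m N : ℝ) / √N = √N * (m N / N)
    rw [div_eq_iff this, mul_right_comm, hsq, mul_div_cancel₀ _ (by positivity)]

/-- An integrable bound for the densities, uniform in `N`. It comes from the Gaussian bound for the
birthday product and `r ^ 2 / 2 - (r + 1) / 2 ≥ r - 2`. -/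
theorem abs_sqrt_mul_cyclicProb_le {r : ℝ} (hr : 0 < r) (N : ℕ) :
    |√(N : ℝ) * cyclicProb N ⌈r * √(N : ℝ)⌉₊| ≤ 2 * Real.exp 2 * Real.exp (-(1 / 2) * r) := by
  rcases eq_or_ne N 0 with rfl | hN
  · simp
    positivity
  set m := ⌈r * √(N : ℝ)⌉₊ with hm
  rcases lt_or_ge N m with hNm | hNm
  · rw [cyclicProb_eq_zero hN hNm]
    simp
    positivity
  have hN1 : (1 : ℝ) ≤ N := by exact_mod_cast Nat.one_le_iff_ne_zero.2 hN
  have hs1 : 1 ≤ √(N : ℝ) := Real.one_le_sqrt.2 hN1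
  have hsq : √(N : ℝ) * √N = N := Real.mul_self_sqrt (Nat.cast_nonneg N)
  have hlow : r * √N ≤ m := Nat.le_ceil _
  have hup : (m : ℝ) ≤ (r + 1) * √N := by
    have := (Nat.ceil_lt_add_one (by positivity : 0 ≤ r * √(N : ℝ))).le
    linarith
  have hprod0 : 0 ≤ ∏ i ∈ Finset.range m, (1 - (i : ℝ) / N) := by
    refine Finset.prod_nonneg fun i hi => ?_
    have : (i : ℝ) ≤ N := by exact_mod_cast (Finset.mem_range.1 hi).le.trans hNm
    exact sub_nonneg.2 (div_le_one_of_le₀ this (Nat.cast_nonneg N))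
  have h1 : √(N : ℝ) * (m / N) ≤ r + 1 := by
    rw [← mul_div_assoc, div_le_iff₀ (by linarith)]
    nlinarith
  have h2 : -((m : ℝ) * (m - 1) / 2 / N) ≤ 2 - r := by
    have h3 : (r ^ 2 - (r + 1)) * N ≤ m * (m - 1) := by
      have h4 : r ^ 2 * N ≤ m * m := by
        calc r ^ 2 * N = (r * √N) * (r * √N) := by rw [mul_mul_mul_comm, hsq, sq]
          _ ≤ m * m := mul_self_le_mul_self (by positivity) hlow
      have h5 : (m : ℝ) ≤ (r + 1) * N := hup.trans (by
        gcongr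
        nlinarith)
      nlinarith
    have h6 : (r ^ 2 - (r + 1)) / 2 ≤ m * (m - 1) / 2 / N := by
      rw [le_div_iff₀ (by linarith)]
      linarith
    nlinarith [sq_nonneg (r - 3 / 2)]
  have h7 : r + 1 ≤ 2 * Real.exp (1 / 2 * r) := by linarith [Real.add_one_le_exp (1 / 2 * r)]
  rw [cyclicProb, ← mul_assoc, abs_of_nonneg (by positivity)]
  calc √(N : ℝ) * (m / N) * ∏ i ∈ Finset.range m, (1 - (i : ℝ) / N)
      ≤ (2 * Real.exp (1 / 2 * r)) * Real.exp (2 - r) :=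
        mul_le_mul (h1.trans h7) ((prod_one_sub_div_le hNm).trans (Real.exp_le_exp.2 h2)) hprod0
          (by positivity)
    _ = 2 * Real.exp 2 * Real.exp (-(1 / 2) * r) := by
        rw [mul_assoc, mul_assoc, ← Real.exp_add, ← Real.exp_add]
        ring_nf

/-! ### The Rayleigh mixture and the limit theorem -/

theorem integrableOn_rayleighDensity :
    IntegrableOn (fun x : ℝ => x * Real.exp (-x ^ 2 / 2)) (Ioi 0)
      ∧ ∫ x in Ioi (0 : ℝ), x * Real.exp (-x ^ 2 / 2) = 1 := by
  have hderiv : ∀ x : ℝ, HasDerivAt (fun x : ℝ => -Real.exp (-x ^ 2 / 2))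
      (x * Real.exp (-x ^ 2 / 2)) x := by
    intro x
    have h1 : HasDerivAt (fun x : ℝ => -x ^ 2 / 2) (-x) x := by
      refine (((hasDerivAt_pow 2 x).neg).div_const 2).congr_deriv ?_
      norm_num
      ring
    refine h1.exp.neg.congr_deriv ?_
    ring
  have hlim : Tendsto (fun x : ℝ => -Real.exp (-x ^ 2 / 2)) atTop (𝓝 0) := by
    rw [← neg_zero]
    refine (Real.tendsto_exp_atBot.comp ?_).neg
    have : Tendsto (fun x : ℝ => x ^ 2 / 2) atTop atTop :=
      (tendsto_pow_atTop two_ne_zero).atTop_div_const two_pos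
    refine (tendsto_neg_atTop_atBot.comp this).congr fun x => ?_
    simp only [Function.comp]
    ring
  have hnonneg : ∀ x ∈ Ioi (0 : ℝ), 0 ≤ x * Real.exp (-x ^ 2 / 2) := fun x hx =>
    mul_nonneg (le_of_lt hx) (Real.exp_pos _).le
  refine ⟨integrableOn_Ioi_deriv_of_nonneg' (fun x _ => hderiv x) hnonneg hlim, ?_⟩
  rw [integral_Ioi_of_hasDerivAt_of_nonneg' (fun x _ => hderiv x) hnonneg hlim]
  simp

instance : IsProbabilityMeasure rayleighMeasure := by
  refine ⟨?_⟩
  rw [rayleighMeasure, withDensity_apply _ MeasurableSet.univ, Measure.restrict_univ,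
    ← ofReal_integral_eq_lintegral_ofReal integrableOn_rayleighDensity.1,
    integrableOn_rayleighDensity.2, ENNReal.ofReal_one]
  filter_upwards [ae_restrict_mem measurableSet_Ioi] with x hx
  exact mul_nonneg (le_of_lt hx) (Real.exp_pos _).le

instance {k : ℕ} (μ : Measure (Fin k → ℝ)) [IsProbabilityMeasure μ] :
    IsProbabilityMeasure (rayleighMixture μ) :=
  Measure.isProbabilityMeasure_map
    (measurable_fst.smul measurable_snd).aemeasurable

theorem integral_rayleighMeasure (f : ℝ → ℝ) :
    ∫ r, f r ∂rayleighMeasure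
      = ∫ r in Ioi (0 : ℝ), r * Real.exp (-r ^ 2 / 2) * f r := by
  rw [rayleighMeasure, integral_withDensity_eq_integral_toReal_smul (by fun_prop)
    (ae_of_all _ fun _ => ENNReal.ofReal_lt_top)]
  refine setIntegral_congr_fun measurableSet_Ioi fun r hr => ?_
  simp only [smul_eq_mul]
  rw [ENNReal.toReal_ofReal (mul_nonneg (le_of_lt hr) (Real.exp_pos _).le)]

theorem integral_rayleighMixture {k : ℕ} (μ : Measure (Fin k → ℝ)) [IsProbabilityMeasure μ]
    (φ : BoundedContinuousFunction (Fin k → ℝ) ℝ) :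
    ∫ x, φ x ∂rayleighMixture μ
      = ∫ r in Ioi (0 : ℝ), r * Real.exp (-r ^ 2 / 2) * ∫ x, φ (r • x) ∂μ := by
  have hm : Measurable fun p : ℝ × (Fin k → ℝ) => p.1 • p.2 := measurable_fst.smul measurable_snd
  have hint : Integrable (fun p : ℝ × (Fin k → ℝ) => φ (p.1 • p.2)) (rayleighMeasure.prod μ) :=
    Integrable.of_bound (φ.continuous.measurable.comp hm).aestronglyMeasurable ‖φ‖
      (ae_of_all _ fun p => φ.norm_coe_le_norm _)
  rw [rayleighMixture, integral_map hm.aemeasurable φ.continuous.measurable.aestronglyMeasurable,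
    integral_prod _ hint, integral_rayleighMeasure]

/-- A product of a Rayleigh variable and an independent positive variable has no atoms. -/
theorem rayleighMixture_coord_eq {k : ℕ} (μ : Measure (Fin k → ℝ)) [IsProbabilityMeasure μ]
    {i : Fin k} (hi : ∀ᵐ x ∂μ, 0 < x i) (c : ℝ) : rayleighMixture μ {x | x i = c} = 0 := by
  have hm : Measurable fun p : ℝ × (Fin k → ℝ) => p.1 • p.2 := measurable_fst.smul measurable_snd
  have hs : MeasurableSet {x : Fin k → ℝ | x i = c} :=
    measurableSet_eq_fun (measurable_pi_apply i) measurable_const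
  rw [rayleighMixture, Measure.map_apply hm hs, Measure.prod_apply_symm (hm hs),
    lintegral_eq_zero_iff (measurable_measure_prodMk_right (hm hs))]
  filter_upwards [hi] with x hx
  have hsub : (fun r : ℝ => (r, x)) ⁻¹' ((fun p : ℝ × (Fin k → ℝ) => p.1 • p.2) ⁻¹'
      {x | x i = c}) ⊆ {c / x i} := by
    intro r hr
    have hr' : r * x i = c := hr
    rw [mem_singleton_iff, ← hr', mul_div_cancel_right₀ _ hx.ne']
  refine measure_mono_null hsub ?_
  exact (withDensity_absolutelyContinuous _ _).trans Measure.restrict_le_self.absolutelyContinuous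
    (measure_singleton _)

/-- The law of the rescaled longest cycles of a random map as an integral over `(0, ∞)`, the
number of periodic points being `⌈r √N⌉`. -/
theorem integral_randomMappingLaw_eq_setIntegral (k : ℕ) {N : ℕ} (hN : N ≠ 0)
    {φ : (Fin k → ℝ) → ℝ} (hφ : Measurable φ) :
    ∫ x, φ x ∂(randomMappingLaw k N : Measure (Fin k → ℝ))
      = ∫ r in Ioi (0 : ℝ), √N * cyclicProb N ⌈r * √N⌉₊
        * ∫ ω, φ ((⌈r * √N⌉₊ / √N : ℝ) • longestPieces k ⌈r * √N⌉₊ ω) ∂iidUniform := by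
  have hs : (0 : ℝ) < √N := by positivity
  set a : ℕ → ℝ := fun m => √N * cyclicProb N m
    * ∫ ω, φ ((m / √N : ℝ) • longestPieces k m ω) ∂iidUniform with ha
  have h1 := intervalIntegral_comp_ceil hs a N
  rw [intervalIntegral.integral_of_le (by positivity)] at h1
  rw [integral_randomMappingLaw k hN hφ]
  change _ = ∫ r in Ioi (0 : ℝ), a ⌈r * √N⌉₊
  rw [setIntegral_eq_of_subset_of_forall_sdiff_eq_zero measurableSet_Ioi Ioc_subset_Ioi_self ?_, h1,
    Finset.mul_sum]
  · refine Finset.sum_congr rfl fun m _ => ?_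
    rw [ha]
    field_simp
  · rintro r ⟨hr0, hr⟩
    have h2 : (N : ℝ) / √N < r := by
      by_contra! h
      exact hr ⟨hr0, h⟩
    rw [ha]
    dsimp only
    rw [cyclicProb_eq_zero hN (Nat.lt_ceil.2 ((div_lt_iff₀ hs).1 h2)), mul_zero, zero_mul]

/-- The number `m N` of periodic points and the scale `c N` may vary with `N`. The choices `c = 1`
and `m = id` give the limit theorem for permutations. -/
theorem tendsto_integral_longestPieces {k : ℕ} {X : (ℕ → ℝ) → Fin k → ℝ}
    (hX : ∀ᵐ ω ∂iidUniform, Tendsto (fun N => longestPieces k N ω) atTop (𝓝 (X ω)))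
    {c : ℕ → ℝ} {m : ℕ → ℕ} {r : ℝ} (hc : Tendsto c atTop (𝓝 r)) (hm : Tendsto m atTop atTop)
    (φ : BoundedContinuousFunction (Fin k → ℝ) ℝ) :
    Tendsto (fun N => ∫ ω, φ (c N • longestPieces k (m N) ω) ∂iidUniform) atTop
      (𝓝 (∫ ω, φ (r • X ω) ∂iidUniform)) := by
  refine tendsto_integral_of_dominated_convergence (fun _ => ‖φ‖) (fun N => ?_)
    (integrable_const _) (fun N => ae_of_all _ fun ω => φ.norm_coe_le_norm _) ?_
  · exact (φ.continuous.measurable.comp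
      ((measurable_longestPieces k (m N)).const_smul (c N))).aestronglyMeasurable
  · filter_upwards [hX] with ω hω
    exact (φ.continuous.tendsto _).comp (hc.smul (hω.comp hm))

theorem tendsto_integral_randomMappingLaw {k : ℕ} {X : (ℕ → ℝ) → Fin k → ℝ}
    (hX : ∀ᵐ ω ∂iidUniform, Tendsto (fun N => longestPieces k N ω) atTop (𝓝 (X ω)))
    (φ : BoundedContinuousFunction (Fin k → ℝ) ℝ) :
    Tendsto (fun N => ∫ x, φ x ∂(randomMappingLaw k N : Measure (Fin k → ℝ))) atTop
      (𝓝 (∫ r in Ioi (0 : ℝ), r * Real.exp (-r ^ 2 / 2) * ∫ ω, φ (r • X ω) ∂iidUniform)) := by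
  have h : Tendsto (fun N : ℕ => ∫ r in Ioi (0 : ℝ), √N * cyclicProb N ⌈r * √N⌉₊
      * ∫ ω, φ ((⌈r * √N⌉₊ / √N : ℝ) • longestPieces k ⌈r * √N⌉₊ ω) ∂iidUniform) atTop
      (𝓝 (∫ r in Ioi (0 : ℝ), r * Real.exp (-r ^ 2 / 2) * ∫ ω, φ (r • X ω) ∂iidUniform)) := by
    refine tendsto_integral_of_dominated_convergence
      (fun r => 2 * Real.exp 2 * Real.exp (-(1 / 2) * r) * ‖φ‖) (fun N => ?_) ?_ (fun N => ?_) ?_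
    · have hm : Measurable fun r : ℝ => ⌈r * √(N : ℝ)⌉₊ :=
        Nat.measurable_ceil.comp (measurable_id.mul_const _)
      exact ((Measurable.of_discrete (f := fun m : ℕ => √N * cyclicProb N m
        * ∫ ω, φ ((m / √N : ℝ) • longestPieces k m ω) ∂iidUniform)).comp hm).aestronglyMeasurable
    · exact ((exp_neg_integrableOn_Ioi 0 (by norm_num)).const_mul _).mul_const _
    · filter_upwards [ae_restrict_mem measurableSet_Ioi] with r hr
      rw [norm_mul, Real.norm_eq_abs]
      refine mul_le_mul (abs_sqrt_mul_cyclicProb_le hr N) ?_ (norm_nonneg _) (by positivity)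
      refine (norm_integral_le_of_norm_le_const
        (ae_of_all _ fun ω => φ.norm_coe_le_norm _)).trans ?_
      simp
    · filter_upwards [ae_restrict_mem measurableSet_Ioi] with r hr
      exact (tendsto_sqrt_mul_cyclicProb hr).mul (tendsto_integral_longestPieces hX
        (tendsto_ceil_mul_sqrt_div hr) (tendsto_ceil_mul_sqrt hr) φ)
  refine h.congr' ?_
  filter_upwards [eventually_ne_atTop 0] with N hN
  rw [integral_randomMappingLaw_eq_setIntegral k hN φ.continuous.measurable]

theorem mainTheorem3 (k : ℕ) :
    ∃ ν : ProbabilityMeasure (Fin k → ℝ),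
      Tendsto (fun N : ℕ => randomMappingLaw k N) atTop (𝓝 ν) ∧
      (∀ (i : Fin k) (c : ℝ), (ν : Measure (Fin k → ℝ)) {x | x i = c} < 1) ∧
      ∃ μ : ProbabilityMeasure (Fin k → ℝ),
        Tendsto (fun N : ℕ => randomPermutationLaw k N) atTop (𝓝 μ) ∧
        (ν : Measure (Fin k → ℝ)) = rayleighMixture (μ : Measure (Fin k → ℝ)) := by
  obtain ⟨X, hXm, hX, hpos⟩ := exists_tendsto_longestPieces k
  have hμ : IsProbabilityMeasure (iidUniform.map X) :=
    Measure.isProbabilityMeasure_map hXm.aemeasurable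
  have hint : ∀ f : (Fin k → ℝ) → ℝ, Measurable f →
      ∫ x, f x ∂iidUniform.map X = ∫ ω, f (X ω) ∂iidUniform := fun f hf =>
    integral_map hXm.aemeasurable hf.aestronglyMeasurable
  -- `X` is the limit for permutations, and its Rayleigh mixture is the limit for maps
  refine ⟨⟨rayleighMixture (iidUniform.map X), inferInstance⟩, ?_, fun i c => ?_,
    ⟨iidUniform.map X, hμ⟩, ?_, rfl⟩
  · refine ProbabilityMeasure.tendsto_iff_forall_integral_tendsto.2 ?_
    intro φ
    change Tendsto _ _ (𝓝 (∫ x, φ x ∂rayleighMixture (iidUniform.map X)))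
    rw [integral_rayleighMixture]
    have hsmul : ∀ r : ℝ, ∫ x, φ (r • x) ∂iidUniform.map X = ∫ ω, φ (r • X ω) ∂iidUniform :=
      fun r => hint _ (φ.continuous.measurable.comp (measurable_id.const_smul r))
    simp only [hsmul]
    exact tendsto_integral_randomMappingLaw hX φ
  · refine lt_of_eq_of_lt (rayleighMixture_coord_eq _ ?_ c) zero_lt_one
    rw [ae_map_iff hXm.aemeasurable (measurableSet_lt measurable_const (measurable_pi_apply i))]
    filter_upwards [hpos] with ω hω using hω i
  · refine ProbabilityMeasure.tendsto_iff_forall_integral_tendsto.2 ?_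
    intro φ
    change Tendsto _ _ (𝓝 (∫ x, φ x ∂iidUniform.map X))
    rw [hint _ φ.continuous.measurable]
    have h := tendsto_integral_longestPieces hX (c := fun _ => 1) tendsto_const_nhds tendsto_id φ
    simp only [one_smul, id] at h
    refine h.congr fun N => ?_
    rw [integral_randomPermutationLaw k N φ.continuous.measurable]
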